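/- For $n\ge 1$ let $\delta_n=n(n-1)\cdots 21\in\mathfrak S_n$ be the longest permutation, and let $R(\delta_n)$ be the set of its reduced words, i.e. the words $i_1i_2\cdots i_k$ of minimal length in the letters $1,\dots,n-1$ with $s_{i_1}s_{i_2}\cdots s_{i_k}=\delta_n$, where $s_i=(i,i+1)$. Let $G_{\delta_n}$ be the graph on $R(\delta_n)$ in which two words are joined by an edge if they differ by a single commutation move (exchanging adjacent letters $j,k$ with $|j-k|>1$) or by a single long braid move (exchanging consecutive letters $j(j+1)j$ and $(j+1)j(j+1)$). Let $C_{\delta_n}$ (respectively $B_{\delta_n}$) be the graph obtained from $G_{\delta_n}$ by contracting all edges that come from commutation moves (respectively long braid moves). These graphs are connected, and their diameters $D(n)=\operatorname{diam}(G_{\delta_n})$, $C(n)=\operatorname{diam}(C_{\delta_n})$ and $B(n)=\operatorname{diam}(B_{\delta_n})$ satisfy $D(1)=C(1)=B(1)=0$ and, for all $n\ge 1$, 1. $D(n+1)=D(n)+(n-1)\binom n2$, 2. $C(n+1)=C(n)+\binom n2$, 3. $B(n+1)=B(n)+(n-2)\binom n2$. In particular, $D(n)=\frac{1}{24}\,n(n-1)(n-2)(3n-5)$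 for all $n\ge 1$, which is the value found by Reiner and Roichman and by Assaf. -/

import Mathlib

namespace ReducedWords

/-- The simple reflection `s_i` of the symmetric group on `n` points. Letters and points are
numbered from `0`, so `i` runs over `0, …, n - 2` and `s_i` interchanges `i` and `i + 1`. -/
def simpleReflection {n : ℕ} (i : Fin (n - 1)) : Equiv.Perm (Fin n) :=
  Equiv.swap ⟨i.1, by omega⟩ ⟨i.1 + 1, by omega⟩

/-- The product `s_{i_1} s_{i_2} ⋯ s_{i_k}` belonging to a word `i_1 i_2 … i_k`. -/
def wordProd {n : ℕ} (w : List (Fin (n - 1))) : Equiv.Perm (Fin n) :=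
  (w.map simpleReflection).prod

/-- `w` is a reduced word of `π`: its product is `π`, and no shorter word has this product. -/
def IsReducedWord {n : ℕ} (π : Equiv.Perm (Fin n)) (w : List (Fin (n - 1))) : Prop :=
  wordProd w = π ∧ ∀ v : List (Fin (n - 1)), wordProd v = π → w.length ≤ v.length

/-- The set `R(π)` of reduced words of `π`. -/
abbrev R {n : ℕ} (π : Equiv.Perm (Fin n)) : Type :=
  {w : List (Fin (n - 1)) // IsReducedWord π w}

/-- A commutation move: adjacent letters `j k` with `|j - k| > 1` are exchanged. -/
def CommMove {n : ℕ} (u v : List (Fin (n - 1))) : Prop :=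
  ∃ (x y : List (Fin (n - 1))) (j k : Fin (n - 1)),
    (j.1 + 1 < k.1 ∨ k.1 + 1 < j.1) ∧ u = x ++ [j, k] ++ y ∧ v = x ++ [k, j] ++ y

/-- A long braid move: consecutive letters `j k j` with `|j - k| = 1` are replaced by `k j k`. -/
def BraidMove {n : ℕ} (u v : List (Fin (n - 1))) : Prop :=
  ∃ (x y : List (Fin (n - 1))) (j k : Fin (n - 1)),
    (k.1 = j.1 + 1 ∨ j.1 = k.1 + 1) ∧ u = x ++ [j, k, j] ++ y ∧ v = x ++ [k, j, k] ++ y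

/-- The graph on `R(π)` formed by the commutation edges. -/
def commGraph {n : ℕ} (π : Equiv.Perm (Fin n)) : SimpleGraph (R π) where
  Adj u v := CommMove u.1 v.1
  symm := ⟨by
    rintro u v ⟨x, y, j, k, h, hu, hv⟩
    exact ⟨x, y, k, j, h.symm, hv, hu⟩⟩
  loopless := ⟨by
    rintro u ⟨x, y, j, k, h, hu, hv⟩
    have e := hu.symm.trans hv
    simp at e
    omega⟩

/-- The graph on `R(π)` formed by the long braid edges. -/
def braidGraph {n : ℕ} (π : Equiv.Perm (Fin n)) : SimpleGraph (R π) where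
  Adj u v := BraidMove u.1 v.1
  symm := ⟨by
    rintro u v ⟨x, y, j, k, h, hu, hv⟩
    exact ⟨x, y, k, j, h.symm, hv, hu⟩⟩
  loopless := ⟨by
    rintro u ⟨x, y, j, k, h, hu, hv⟩
    have e := hu.symm.trans hv
    simp at e
    omega⟩

/-- The contraction of the graph `G` along the edges of `H`: the vertices are the connected
components of `H`, and two different components are joined if some edge of `G` runs between them. -/
def contractAlong {V : Type*} (G H : SimpleGraph V) : SimpleGraph H.ConnectedComponent where
  Adj S T := S ≠ T ∧ ∃ u v : V,
    H.connectedComponentMk u = S ∧ H.connectedComponentMk v = T ∧ G.Adj u v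
  symm := ⟨by
    rintro S T ⟨h, u, v, hu, hv, e⟩
    exact ⟨h.symm, v, u, hv, hu, e.symm⟩⟩
  loopless := ⟨fun _ h => h.1 rfl⟩

/-- The graph `G_π` on `R(π)`, with the commutation edges and the long braid edges. -/
def graphG {n : ℕ} (π : Equiv.Perm (Fin n)) : SimpleGraph (R π) :=
  commGraph π ⊔ braidGraph π

/-- The graph `C_π`: `G_π` contracted along the commutation edges. Its vertices are the
commutation classes. -/
def graphC {n : ℕ} (π : Equiv.Perm (Fin n)) : SimpleGraph (commGraph π).ConnectedComponent :=
  contractAlong (graphG π) (commGraph π)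

/-- The graph `B_π`: `G_π` contracted along the long braid edges. Its vertices are the
braid classes. -/
def graphB {n : ℕ} (π : Equiv.Perm (Fin n)) : SimpleGraph (braidGraph π).ConnectedComponent :=
  contractAlong (graphG π) (braidGraph π)

/-- The longest permutation `δ_n = n ⋯ 2 1`. -/
def longest (n : ℕ) : Equiv.Perm (Fin n) := Fin.revPerm

/-- `R(π)` is finite, so that in the connected graphs above the distances are bounded and
`SimpleGraph.diam` is their maximum. -/
instance finite_R {n : ℕ} (π : Equiv.Perm (Fin n)) : Finite (R π) := by
  by_cases h : ∃ w₀, IsReducedWord π w₀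
  · obtain ⟨w₀, h₀⟩ := h
    exact ((List.finite_length_le (Fin (n - 1)) w₀.length).subset
      (fun w (hw : IsReducedWord π w) => hw.2 w₀ h₀.1)).to_subtype
  · have : IsEmpty (R π) := ⟨fun w => h ⟨w.1, w.2⟩⟩
    infer_instance

/-- `D(n) = diam (G_{δ_n})`. -/
noncomputable def D (n : ℕ) : ℕ := (graphG (longest n)).diam

/-- `C(n) = diam (C_{δ_n})`. -/
noncomputable def C (n : ℕ) : ℕ := (graphC (longest n)).diam

/-- `B(n) = diam (B_{δ_n})`. -/
noncomputable def B (n : ℕ) : ℕ := (graphB (longest n)).diam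

end ReducedWords

/-!
Read a reduced word of `δ_n` as a sorting process: each letter makes two adjacent values `a < b`
cross, every pair crosses exactly once, and for `a < b < c` the pairs cross in the order
`ab, ac, bc` or `bc, ac, ab`. Such convex orders of the pairs determine the reduced word. A long
braid move reverses exactly one triple, and a commutation move exchanges exactly two disjoint
pairs. Hence the number of reversed triples and the number of disjoint pairs of pairs that are in
the non-standard order change by at most one along an edge, each along its own kind of move. Every
convex order other than the standard one admits a move that lowers one of the two numbers, and, by
reversal, every one other than the reversed standard order admits a move that raises one. Two words
are therefore joined through the bottom or through the top word by a path no longer than the total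
number of triples and disjoint pairs of pairs, which is also the distance from bottom to top. This
gives `D(n) = 3 * choose n 4 + choose n 3`, `C(n) = choose n 3` and `B(n) = 3 * choose n 4`.
-/

namespace ReducedWords

section Lists

variable {α : Type*} [DecidableEq α]

/-- `p` occurs before `q` in the list `l`. An entry that does not occur in `l` has the index
`l.length` and hence counts as coming after all entries of `l`. -/
def Before (l : List α) (p q : α) : Prop :=
  l.idxOf p < l.idxOf q

instance (l : List α) (p q : α) : Decidable (Before l p q) :=
  inferInstanceAs (Decidable (_ < _))

theorem Before.asymm {l : List α} {p q : α} (h : Before l p q) : ¬ Before l q p :=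
  Nat.lt_asymm h

theorem Before.trans {l : List α} {p q r : α} (h : Before l p q) (h' : Before l q r) :
    Before l p r :=
  Nat.lt_trans h h'

theorem before_or_before {l : List α} {p q : α} (hp : p ∈ l) (hpq : p ≠ q) :
    Before l p q ∨ Before l q p :=
  lt_or_gt_of_ne ((List.idxOf_inj hp).not.2 hpq)

theorem notMem_of_nodup_append_cons {α : Type*} {x y : List α} {p : α}
    (h : (x ++ p :: y).Nodup) : p ∉ x :=
  fun hx => (List.nodup_cons.1 (List.nodup_middle.1 h)).1 (List.mem_append_left _ hx)

theorem before_append_cons_left {x y : List α} {p q : α} (hp : p ∉ x) :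
    Before (x ++ p :: y) q p ↔ q ∈ x := by
  simp only [Before, List.idxOf_append, if_neg hp, List.idxOf_cons_self, zero_add]
  split_ifs with hq
  · exact iff_of_true (List.idxOf_lt_length_of_mem hq) hq
  · exact iff_of_false (by omega) hq

theorem before_append_cons_right {x y : List α} {p q : α} (hp : p ∉ x) (hpq : p ≠ q) :
    Before (x ++ p :: y) p q ↔ q ∉ x := by
  rw [← before_append_cons_left (y := y) hp]
  exact ⟨Before.asymm, (before_or_before (by simp) hpq).resolve_right⟩

theorem before_append_cons_cons {x y : List α} {p q : α} (h : (x ++ p :: q :: y).Nodup) :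
    Before (x ++ p :: q :: y) p q := by
  rw [List.append_cons] at h ⊢
  exact (before_append_cons_left (notMem_of_nodup_append_cons h)).2 (by simp)

theorem Before.of_adjacent {x y : List α} {p q r : α} (h : (x ++ p :: q :: y).Nodup)
    (hr : Before (x ++ p :: q :: y) r q) (hrp : r ≠ p) : Before (x ++ p :: q :: y) r p := by
  refine (before_append_cons_left (notMem_of_nodup_append_cons h)).2 ?_
  rw [List.append_cons] at h hr
  simpa [hrp] using (before_append_cons_left (notMem_of_nodup_append_cons h)).1 hr

theorem before_reverse_iff {l : List α} {p q : α} (h : l.Nodup) (hp : p ∈ l) (hq : q ∈ l) :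
    Before l.reverse p q ↔ Before l q p := by
  rcases eq_or_ne p q with rfl | hpq
  · exact iff_of_false (lt_irrefl _) (lt_irrefl _)
  obtain ⟨x, y, rfl⟩ := List.append_of_mem hp
  obtain ⟨hpxy, hxy⟩ := List.nodup_cons.1 (List.nodup_middle.1 h)
  obtain ⟨hpx, hpy⟩ := not_or.1 (List.mem_append.not.1 hpxy)
  have hqxy : q ∈ x → q ∉ y := fun hqx hqy => (List.nodup_append.1 hxy).2.2 q hqx q hqy rfl
  have hq : q ∈ x ∨ q ∈ y := by simpa [hpq.symm] using hq
  rw [List.reverse_append, List.reverse_cons, List.append_assoc, List.singleton_append,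
    before_append_cons_right (by simpa using hpy) hpq, before_append_cons_left hpx,
    List.mem_reverse]
  tauto

theorem before_append_append_iff {x m y : List α} {p q : α} (hp : p ∈ m) (hq : q ∈ m)
    (hpx : p ∉ x) (hqx : q ∉ x) : Before (x ++ m ++ y) p q ↔ Before m p q := by
  simp [Before, List.idxOf_append, hp, hq, hpx, hqx]

theorem before_reverse_factor_iff {x m y : List α} {p q : α} (h : ¬ (p ∈ m ∧ q ∈ m)) :
    Before (x ++ m.reverse ++ y) p q ↔ Before (x ++ m ++ y) p q := by
  simp only [Before, List.idxOf_append, List.mem_append, List.mem_reverse, List.length_append,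
    List.length_reverse]
  grind

theorem rel_of_before {r : α → α → Prop} {x y : List α} {p q : α} (hx : x.Pairwise r)
    (hq : q ∈ x) (hpq : Before (x ++ y) p q) : r p q := by
  have hp : p ∈ x := by
    by_contra hp
    have := List.idxOf_lt_length_of_mem hq
    simp only [Before, List.idxOf_append, if_pos hq, if_neg hp] at hpq
    omega
  simp only [Before, List.idxOf_append, if_pos hp, if_pos hq] at hpq
  simpa using List.pairwise_iff_getElem.1 hx _ _ (List.idxOf_lt_length_of_mem hp)
    (List.idxOf_lt_length_of_mem hq) hpq

theorem pairwise_of_forall_before {l : List α} {r : α → α → Prop} (h : l.Nodup)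
    (hr : ∀ p ∈ l, ∀ q ∈ l, Before l p q → r p q) : l.Pairwise r := by
  refine List.pairwise_iff_getElem.2 fun i j hi hj hij => ?_
  refine hr _ (List.getElem_mem hi) _ (List.getElem_mem hj) ?_
  rwa [Before, h.idxOf_getElem, h.idxOf_getElem]

theorem pairwise_or_exists_descent {α β : Type*} [LinearOrder β] (f : α → β) (l : List α) :
    l.Pairwise (fun p q => f p ≤ f q) ∨ ∃ x p q y, l = x ++ p :: q :: y ∧
      (x ++ [p]).Pairwise (fun p q => f p ≤ f q) ∧ f q < f p := by
  induction l using List.reverseRecOn with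
  | nil => simp
  | append_singleton l q ih =>
    rcases ih with h | ⟨x, p, q', y, rfl, h, hd⟩
    · rcases List.eq_nil_or_concat' l with rfl | ⟨x, p, rfl⟩
      · simp
      · rcases le_or_gt (f p) (f q) with hpq | hqp
        · have : IsTrans α fun p q => f p ≤ f q := ⟨fun _ _ _ => le_trans⟩
          rw [← List.isChain_iff_pairwise] at h ⊢
          exact Or.inl (List.isChain_append.2 ⟨h, by simp, by simpa using hpq⟩)
        · exact Or.inr ⟨x, p, q, [], by simp, h, hqp⟩
    · exact Or.inr ⟨x, p, q', y ++ [q], by simp, h, hd⟩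

/-- The number of pairs `(p, q) ∈ S` that occur in `l` in the order `q`, `p`. -/
def reversals (S : Finset (α × α)) (l : List α) : ℕ :=
  (S.filter fun e => Before l e.2 e.1).card

theorem reversals_eq_zero_iff {S : Finset (α × α)} {l : List α} :
    reversals S l = 0 ↔ ∀ e ∈ S, ¬ Before l e.2 e.1 := by
  rw [reversals, Finset.card_eq_zero, Finset.filter_eq_empty_iff]

theorem reversals_eq_zero_of_pairwise {r : α → α → Prop} {S : Finset (α × α)} {l : List α}
    (hl : l.Pairwise r) (hS : ∀ e ∈ S, e.1 ∈ l ∧ ¬ r e.2 e.1) : reversals S l = 0 :=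
  reversals_eq_zero_iff.2 fun e he hb =>
    (hS e he).2 (rel_of_before hl (hS e he).1 (y := []) (by rwa [List.append_nil]))

theorem reversals_reverse_add {S : Finset (α × α)} {l : List α} (h : l.Nodup)
    (hS : ∀ e ∈ S, e.1 ∈ l ∧ e.2 ∈ l ∧ e.1 ≠ e.2) :
    reversals S l.reverse + reversals S l = S.card := by
  rw [← Finset.card_filter_add_card_filter_not (s := S) (fun e => Before l e.2 e.1), add_comm,
    reversals, reversals]
  congr 2
  refine Finset.filter_congr fun e he => ?_
  obtain ⟨h1, h2, hne⟩ := hS e he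
  rw [before_reverse_iff h h2 h1]
  exact ⟨Before.asymm, (before_or_before h1 hne).resolve_right⟩

section ReverseFactor

variable {S : Finset (α × α)} {x m y : List α} {e₀ : α × α}

theorem reversals_reverse_factor_eq (h : ∀ e ∈ S, e.1 ∈ m → e.2 ∉ m) :
    reversals S (x ++ m.reverse ++ y) = reversals S (x ++ m ++ y) :=
  congrArg Finset.card <| Finset.filter_congr fun e he =>
    before_reverse_factor_iff fun hm => h e he hm.2 hm.1

theorem reversals_reverse_factor_le (h : ∀ e ∈ S, e.1 ∈ m → e.2 ∈ m → e = e₀) :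
    reversals S (x ++ m.reverse ++ y) ≤ reversals S (x ++ m ++ y) + 1 := by
  refine (Finset.card_le_card fun e he => ?_).trans (Finset.card_insert_le e₀ _)
  rw [Finset.mem_filter] at he
  by_cases hm : e.2 ∈ m ∧ e.1 ∈ m
  · exact Finset.mem_insert.2 (Or.inl (h e he.1 hm.2 hm.1))
  · exact Finset.mem_insert_of_mem
      (Finset.mem_filter.2 ⟨he.1, (before_reverse_factor_iff hm).1 he.2⟩)

theorem reversals_reverse_factor_lt (hnd : (x ++ m ++ y).Nodup)
    (h : ∀ e ∈ S, e.1 ∈ m → e.2 ∈ m → e = e₀) (he₀ : e₀ ∈ S) (h₁ : e₀.1 ∈ m) (h₂ : e₀.2 ∈ m)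
    (hb : Before m e₀.2 e₀.1) :
    reversals S (x ++ m.reverse ++ y) < reversals S (x ++ m ++ y) := by
  obtain ⟨hxm, -, -⟩ := List.nodup_append.1 hnd
  obtain ⟨-, hm, hdisj⟩ := List.nodup_append.1 hxm
  have notMem {p} (hp : p ∈ m) : p ∉ x := fun hx => hdisj p hx p hp rfl
  have hlast : ¬ Before (x ++ m.reverse ++ y) e₀.2 e₀.1 := by
    rw [before_append_append_iff (by simpa) (by simpa) (notMem h₂) (notMem h₁),
      before_reverse_iff hm h₂ h₁]
    exact hb.asymm
  refine Finset.card_lt_card (Finset.ssubset_iff_of_subset ?_ |>.2 ⟨e₀, ?_, ?_⟩)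
  · intro e he
    rw [Finset.mem_filter] at he ⊢
    refine ⟨he.1, (before_reverse_factor_iff fun hm => hlast ?_).1 he.2⟩
    exact h e he.1 hm.2 hm.1 ▸ he.2
  · exact Finset.mem_filter.2
      ⟨he₀, (before_append_append_iff h₂ h₁ (notMem h₂) (notMem h₁)).2 hb⟩
  · exact fun h₀ => hlast (Finset.mem_filter.1 h₀).2

end ReverseFactor

end Lists

section Pairs

/-- The pairs `a < b < n`. -/
def pairs (n : ℕ) : Finset (ℕ × ℕ) :=
  (Finset.range n ×ˢ Finset.range n).filter fun p => p.1 < p.2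

/-- The pairs of pairs `(a, b)`, `(b, c)` with `a < b < c < n`, one for each triple: the order in
which they occur in a convex order decides the order of all three pairs of the triple. -/
def triples (n : ℕ) : Finset ((ℕ × ℕ) × (ℕ × ℕ)) :=
  (pairs n ×ˢ pairs n).filter fun e => e.1.2 = e.2.1

/-- The pairs of pairs `(a, b)`, `(c, d)` without a common point, for which `b < d`. -/
def quadruples (n : ℕ) : Finset ((ℕ × ℕ) × (ℕ × ℕ)) :=
  (pairs n ×ˢ pairs n).filter fun e =>
    e.1.2 < e.2.2 ∧ e.1.1 ≠ e.2.1 ∧ e.1.2 ≠ e.2.1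

variable {n a b c d : ℕ}

theorem mem_pairs : (a, b) ∈ pairs n ↔ a < b ∧ b < n := by
  simp only [pairs, Finset.mem_filter, Finset.mem_product, Finset.mem_range]
  omega

theorem mem_triples :
    ((a, b), (c, d)) ∈ triples n ↔ a < b ∧ b = c ∧ c < d ∧ d < n := by
  simp only [triples, Finset.mem_filter, Finset.mem_product, mem_pairs]
  omega

theorem mem_quadruples :
    ((a, b), (c, d)) ∈ quadruples n ↔ a < b ∧ c < d ∧ b < d ∧ a ≠ c ∧ b ≠ c ∧ d < n := by
  simp only [quadruples, Finset.mem_filter, Finset.mem_product, mem_pairs]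
  omega

theorem sum_range_choose_eq (n k : ℕ) :
    ∑ m ∈ Finset.range n, m.choose k = n.choose (k + 1) := by
  induction n with
  | zero => rfl
  | succ n ih => rw [Finset.sum_range_succ, ih, Nat.choose_succ_succ', add_comm]

theorem card_pairs (n : ℕ) : (pairs n).card = n.choose 2 := by
  have : (pairs n).card = ((Finset.range n).sigma Finset.range).card := by
    refine Finset.card_nbij' (fun p => ⟨p.2, p.1⟩) (fun s => (s.2, s.1)) ?_ ?_ ?_ ?_ <;>
      simp +contextual [Set.MapsTo, Set.LeftInvOn, mem_pairs]
  simpa [this] using sum_range_choose_eq n 1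

theorem card_triples (n : ℕ) : (triples n).card = n.choose 3 := by
  have : (triples n).card = ((Finset.range n).sigma pairs).card := by
    refine Finset.card_nbij' (fun e => ⟨e.2.2, e.1⟩) (fun s => (s.2, (s.2.2, s.1)))
      ?_ ?_ ?_ (fun _ _ => rfl)
    all_goals
      simp only [Set.MapsTo, Set.LeftInvOn, Sigma.forall, Prod.forall, Finset.mem_coe, mem_triples,
        Finset.mem_sigma, mem_pairs, Finset.mem_range, Prod.mk.injEq, true_and, and_true]
      omega
  simpa [this, card_pairs] using sum_range_choose_eq n 2

theorem card_quadruples (n : ℕ) : (quadruples n).card = 3 * n.choose 4 := by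
  have : (quadruples n).card = ((Finset.range n).sigma fun d =>
      (pairs d).sigma fun p => Finset.range d \ {p.1, p.2}).card := by
    refine Finset.card_nbij' (fun e => ⟨e.2.2, e.1, e.2.1⟩) (fun s => (s.2.1, (s.2.2, s.1)))
      ?_ ?_ (fun _ _ => rfl) (fun _ _ => rfl)
    all_goals
      simp only [Set.MapsTo, Sigma.forall, Prod.forall, Finset.mem_coe, mem_quadruples,
        Finset.mem_sigma, mem_pairs, Finset.mem_range, Finset.mem_sdiff, Finset.mem_insert,
        Finset.mem_singleton]
      omega
  rw [this, Finset.card_sigma, ← sum_range_choose_eq, Finset.mul_sum]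
  refine Finset.sum_congr rfl fun d _ => ?_
  rw [Finset.card_sigma, mul_comm 3, Nat.choose_succ_right_eq, ← card_pairs]
  refine Finset.sum_const_nat fun ⟨a, b⟩ hp => ?_
  have := mem_pairs.1 hp
  rw [Finset.card_sdiff_of_subset, Finset.card_pair (by simp only; omega), Finset.card_range]
  simp only [Finset.insert_subset_iff, Finset.singleton_subset_iff, Finset.mem_range]
  omega

end Pairs

/-- The lists that occur as crossing sequences of reduced words of the longest permutation: they
enumerate all pairs, and for `a < b < c` the pair `(a, c)` lies between `(a, b)` and `(b, c)`. -/
structure IsConvexOrder (n : ℕ) (l : List (ℕ × ℕ)) : Prop where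
  nodup : l.Nodup
  mem_iff : ∀ p, p ∈ l ↔ p ∈ pairs n
  convex : ∀ a b c, a < b → b < c → c < n →
    (Before l (a, b) (a, c) ∧ Before l (a, c) (b, c)) ∨
    (Before l (b, c) (a, c) ∧ Before l (a, c) (a, b))

/-- The effect of a commutation move on a crossing sequence: two adjacent pairs without a common
point are exchanged. -/
def PairCommMove (l l' : List (ℕ × ℕ)) : Prop :=
  ∃ x y p q, (p.1 ≠ q.1 ∧ p.1 ≠ q.2 ∧ p.2 ≠ q.1 ∧ p.2 ≠ q.2) ∧
    l = x ++ [p, q] ++ y ∧ l' = x ++ [q, p] ++ y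

/-- The effect of a long braid move on a crossing sequence: the consecutive pairs of a triple are
reversed. -/
def PairBraidMove (l l' : List (ℕ × ℕ)) : Prop :=
  ∃ x m y a b c, a < b ∧ b < c ∧ (m = [(a, b), (a, c), (b, c)] ∨ m = [(b, c), (a, c), (a, b)]) ∧
    l = x ++ m ++ y ∧ l' = x ++ m.reverse ++ y

section PairMoves

variable {n : ℕ} {l l' : List (ℕ × ℕ)}

theorem PairCommMove.reverse (h : PairCommMove l l') : PairCommMove l.reverse l'.reverse := by
  obtain ⟨x, y, p, q, ⟨h1, h2, h3, h4⟩, rfl, rfl⟩ := h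
  exact ⟨y.reverse, x.reverse, q, p, ⟨h1.symm, h3.symm, h2.symm, h4.symm⟩, by simp, by simp⟩

theorem PairBraidMove.reverse (h : PairBraidMove l l') : PairBraidMove l.reverse l'.reverse := by
  obtain ⟨x, m, y, a, b, c, hab, hbc, hm, rfl, rfl⟩ := h
  refine ⟨y.reverse, m.reverse, x.reverse, a, b, c, hab, hbc, ?_, by simp, by simp⟩
  rcases hm with rfl | rfl <;> simp

theorem PairCommMove.reversals_triples (h : PairCommMove l l') :
    reversals (triples n) l' = reversals (triples n) l := by
  obtain ⟨x, y, ⟨a, b⟩, ⟨c, d⟩, hpq, rfl, rfl⟩ := h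
  refine reversals_reverse_factor_eq (m := [(a, b), (c, d)]) ?_
  rintro ⟨⟨i, j⟩, ⟨k, m⟩⟩ he
  rw [mem_triples] at he
  simp only [List.mem_cons, List.not_mem_nil, or_false, Prod.mk.injEq, ne_eq] at hpq ⊢
  omega

theorem eq_of_mem_quadruples {p q : ℕ × ℕ} (hpq : p.2 ≤ q.2) {e : (ℕ × ℕ) × (ℕ × ℕ)}
    (he : e ∈ quadruples n) (h₁ : e.1 ∈ [p, q]) (h₂ : e.2 ∈ [p, q]) : e = (p, q) := by
  have hlt : e.1.2 < e.2.2 := (Finset.mem_filter.1 he).2.1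
  simp only [List.mem_cons, List.not_mem_nil, or_false] at h₁ h₂
  rcases h₁ with h₁ | h₁ <;> rcases h₂ with h₂ | h₂ <;> rw [h₁, h₂] at hlt
  · exact absurd hlt (lt_irrefl _)
  · exact Prod.ext h₁ h₂
  · exact absurd hlt hpq.not_gt
  · exact absurd hlt (lt_irrefl _)

theorem PairCommMove.reversals_quadruples_le (h : PairCommMove l l') :
    reversals (quadruples n) l' ≤ reversals (quadruples n) l + 1 := by
  obtain ⟨x, y, p, q, -, rfl, rfl⟩ := h
  rcases le_total p.2 q.2 with hpq | hqp
  · exact reversals_reverse_factor_le (m := [p, q]) fun e => eq_of_mem_quadruples hpq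
  · exact reversals_reverse_factor_le (m := [p, q]) fun e he h₁ h₂ =>
      eq_of_mem_quadruples hqp he (List.mem_reverse.2 h₁) (List.mem_reverse.2 h₂)

theorem PairBraidMove.reversals_quadruples (h : PairBraidMove l l') :
    reversals (quadruples n) l' = reversals (quadruples n) l := by
  obtain ⟨x, m, y, a, b, c, hab, hbc, hm, rfl, rfl⟩ := h
  refine reversals_reverse_factor_eq ?_
  rintro ⟨⟨i, j⟩, ⟨k, o⟩⟩ he
  rw [mem_quadruples] at he
  rcases hm with rfl | rfl <;>
    simp only [List.mem_cons, List.not_mem_nil, or_false, Prod.mk.injEq] <;> omega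

theorem eq_of_mem_triples {m : List (ℕ × ℕ)} {a b c : ℕ} (hab : a < b) (hbc : b < c)
    (hm : m = [(a, b), (a, c), (b, c)] ∨ m = [(b, c), (a, c), (a, b)])
    {e : (ℕ × ℕ) × (ℕ × ℕ)} (he : e ∈ triples n) (h₁ : e.1 ∈ m) (h₂ : e.2 ∈ m) :
    e = ((a, b), (b, c)) := by
  obtain ⟨⟨i, j⟩, ⟨k, o⟩⟩ := e
  rw [mem_triples] at he
  rcases hm with rfl | rfl <;>
    simp only [List.mem_cons, List.not_mem_nil, or_false, Prod.mk.injEq] at h₁ h₂ ⊢ <;> omega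

theorem PairBraidMove.reversals_triples_le (h : PairBraidMove l l') :
    reversals (triples n) l' ≤ reversals (triples n) l + 1 := by
  obtain ⟨x, m, y, a, b, c, hab, hbc, hm, rfl, rfl⟩ := h
  exact reversals_reverse_factor_le fun e => eq_of_mem_triples hab hbc hm

end PairMoves

namespace IsConvexOrder

variable {n : ℕ} {l l' : List (ℕ × ℕ)}

theorem mem (h : IsConvexOrder n l) {a b : ℕ} (hab : a < b) (hb : b < n) : (a, b) ∈ l :=
  (h.mem_iff _).2 (mem_pairs.2 ⟨hab, hb⟩)

theorem lt_and_lt_of_mem (h : IsConvexOrder n l) {a b : ℕ} (hab : (a, b) ∈ l) : a < b ∧ b < n :=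
  mem_pairs.1 ((h.mem_iff _).1 hab)

theorem reverse (h : IsConvexOrder n l) : IsConvexOrder n l.reverse where
  nodup := List.nodup_reverse.2 h.nodup
  mem_iff p := by rw [List.mem_reverse, h.mem_iff]
  convex a b c hab hbc hc := by
    have hab' := h.mem hab (hbc.trans hc)
    have hac' := h.mem (hab.trans hbc) hc
    have hbc' := h.mem hbc hc
    rw [before_reverse_iff h.nodup hab' hac', before_reverse_iff h.nodup hac' hbc',
      before_reverse_iff h.nodup hbc' hac', before_reverse_iff h.nodup hac' hab']
    exact (h.convex a b c hab hbc hc).symm.imp And.symm And.symm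

theorem reversals_triples_reverse_add (h : IsConvexOrder n l) :
    reversals (triples n) l.reverse + reversals (triples n) l = (triples n).card := by
  refine reversals_reverse_add h.nodup ?_
  rintro ⟨⟨a, b⟩, ⟨c, d⟩⟩ he
  simp only [h.mem_iff, mem_pairs, mem_triples, ne_eq, Prod.mk.injEq] at he ⊢
  omega

theorem reversals_quadruples_reverse_add (h : IsConvexOrder n l) :
    reversals (quadruples n) l.reverse + reversals (quadruples n) l = (quadruples n).card := by
  refine reversals_reverse_add h.nodup ?_
  rintro ⟨⟨a, b⟩, ⟨c, d⟩⟩ he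
  simp only [h.mem_iff, mem_pairs, mem_quadruples, ne_eq, Prod.mk.injEq] at he ⊢
  omega

theorem reversals_eq_zero_of_pairwise (h : IsConvexOrder n l)
    (hl : l.Pairwise fun p q => p.2 ≤ q.2) :
    reversals (triples n) l = 0 ∧ reversals (quadruples n) l = 0 := by
  constructor <;> refine ReducedWords.reversals_eq_zero_of_pairwise hl ?_ <;>
    rintro ⟨⟨a, b⟩, ⟨c, d⟩⟩ he <;>
    simp only [h.mem_iff, mem_pairs, mem_triples, mem_quadruples] at he ⊢ <;> omega

section Descent

variable {x y : List (ℕ × ℕ)} {i j k m : ℕ}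

theorem exists_pairCommMove_of_descent (h : IsConvexOrder n (x ++ (k, m) :: (i, j) :: y))
    (hjm : j < m) (hki : k ≠ i) (hkj : k ≠ j) :
    ∃ l', PairCommMove (x ++ (k, m) :: (i, j) :: y) l' ∧
      reversals (quadruples n) l' < reversals (quadruples n) (x ++ (k, m) :: (i, j) :: y) := by
  have hkm := h.lt_and_lt_of_mem (a := k) (b := m) (by simp)
  have hij := h.lt_and_lt_of_mem (a := i) (b := j) (by simp)
  have hnd := h.nodup
  rw [List.append_cons, List.append_cons, List.append_assoc x] at hnd ⊢
  refine ⟨x ++ [(i, j), (k, m)] ++ y,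
    ⟨x, y, (k, m), (i, j), ⟨hki, hkj, by simp only; omega, hjm.ne'⟩, rfl, rfl⟩, ?_⟩
  refine reversals_reverse_factor_lt (m := [(k, m)] ++ [(i, j)]) (e₀ := ((i, j), (k, m))) hnd
    (fun e he h₁ h₂ => ?_) (mem_quadruples.2 (by omega)) (by simp) (by simp) ?_
  · exact eq_of_mem_quadruples hjm.le he (List.mem_reverse.2 h₁) (List.mem_reverse.2 h₂)
  · exact (before_append_cons_left (by simp [hki.symm])).2 (by simp)

theorem ne_of_descent (h : IsConvexOrder n (x ++ (k, m) :: (i, j) :: y)) (hjm : j < m) :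
    k ≠ j := by
  rintro rfl
  have hkm := h.lt_and_lt_of_mem (a := k) (b := m) (by simp)
  have hik := h.lt_and_lt_of_mem (a := i) (b := k) (by simp)
  rcases h.convex i k m hik.1 hjm hkm.2 with ⟨hik_im, him_km⟩ | ⟨hkm_im, him_ik⟩
  · exact (hik_im.trans him_km).asymm (before_append_cons_cons h.nodup)
  · exact hkm_im.asymm (him_ik.of_adjacent h.nodup (by simp; omega))

theorem before_of_descent (h : IsConvexOrder n (x ++ (i, m) :: (i, j) :: y)) (hjm : j < m) :
    Before (x ++ (i, m) :: (i, j) :: y) (j, m) (i, m) := by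
  have him := h.lt_and_lt_of_mem (a := i) (b := m) (by simp)
  have hij := h.lt_and_lt_of_mem (a := i) (b := j) (by simp)
  rcases h.convex i j m hij.1 hjm him.2 with ⟨hij_im, -⟩ | ⟨hjm_im, -⟩
  · exact absurd (before_append_cons_cons h.nodup) hij_im.asymm
  · exact hjm_im

theorem not_before_and_before_of_gap (h : IsConvexOrder n l) (hij : i < j) (hjm : j < m)
    (hkm : k < m) (hmn : m < n)
    (gap : ∀ a b, b < m → (a, b) ≠ (i, j) → Before l (j, m) (a, b) → Before l (i, j) (a, b)) :
    ¬ (Before l (j, m) (k, m) ∧ Before l (k, m) (i, m)) := by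
  -- Convexity of the triples that contain `m` places the pairs of `{i, j, k}` other than `(i, j)`
  -- either before `(j, m)` or, by `gap`, after `(i, j)`. In each of the possible orders of
  -- `i`, `j`, `k` this contradicts the convexity of this triple.
  rintro ⟨hjk, hki⟩
  have hconv := h.convex
  simp only [Before] at *
  rcases lt_or_ge k j with hkj | hkj <;> rcases lt_or_ge k i with hki' | hki' <;> grind

theorem eq_of_descent (h : IsConvexOrder n (x ++ (k, m) :: (i, m) :: (i, j) :: y))
    (hs : (x ++ [(k, m), (i, m)]).Pairwise fun p q => p.2 ≤ q.2) (hjm : j < m) : k = j := by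
  have hkm := h.lt_and_lt_of_mem (a := k) (b := m) (by simp)
  have hij := h.lt_and_lt_of_mem (a := i) (b := j) (by simp)
  have hjm_im : Before (x ++ (k, m) :: (i, m) :: (i, j) :: y) (j, m) (i, m) := by
    simpa using before_of_descent (x := x ++ [(k, m)]) (by simpa using h) hjm
  have hkm_im := before_append_cons_cons h.nodup
  by_contra hkj
  refine h.not_before_and_before_of_gap hij.1 hjm hkm.1 hkm.2 (fun a b hbm hab hb => ?_)
    ⟨hjm_im.of_adjacent h.nodup (by simp [Ne.symm hkj]), hkm_im⟩
  have hnd := h.nodup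
  have hsplit : x ++ (k, m) :: (i, m) :: (i, j) :: y =
    x ++ [(k, m), (i, m)] ++ (i, j) :: y := by simp
  rw [hsplit] at hb hnd ⊢
  exact (before_append_cons_right (notMem_of_nodup_append_cons hnd) hab.symm).2
    fun hx => (rel_of_before hs hx hb).not_gt hbm

theorem exists_eq_append_of_descent (h : IsConvexOrder n (x ++ (i, m) :: (i, j) :: y))
    (hs : (x ++ [(i, m)]).Pairwise fun p q => p.2 ≤ q.2) (hjm : j < m) :
    ∃ x', x = x' ++ [(j, m)] := by
  have hjx : (j, m) ∈ x := (before_append_cons_left (notMem_of_nodup_append_cons h.nodup)).1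
    (h.before_of_descent hjm)
  obtain ⟨x, ⟨k, m'⟩, rfl⟩ := (List.eq_nil_or_concat' x).resolve_left (List.ne_nil_of_mem hjx)
  obtain ⟨hsx, -, hsi⟩ := List.pairwise_append.1 hs
  obtain rfl : m' = m := by
    refine le_antisymm (hsi (k, m') (by simp) (i, m) (by simp)) ?_
    rcases List.mem_append.1 hjx with hjx | hjx
    · exact (List.pairwise_append.1 hsx).2.2 (j, m) hjx (k, m') (by simp)
    · exact (congrArg Prod.snd (List.mem_singleton.1 hjx)).le
  simp only [List.append_assoc, List.singleton_append] at h hs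
  exact ⟨x, by rw [h.eq_of_descent hs hjm]⟩

theorem exists_pairBraidMove_of_descent (h : IsConvexOrder n (x ++ (i, m) :: (i, j) :: y))
    (hs : (x ++ [(i, m)]).Pairwise fun p q => p.2 ≤ q.2) (hjm : j < m) :
    ∃ l', PairBraidMove (x ++ (i, m) :: (i, j) :: y) l' ∧
      reversals (triples n) l' < reversals (triples n) (x ++ (i, m) :: (i, j) :: y) := by
  obtain ⟨x, rfl⟩ := h.exists_eq_append_of_descent hs hjm
  have him := h.lt_and_lt_of_mem (a := i) (b := m) (by simp)
  have hij := h.lt_and_lt_of_mem (a := i) (b := j) (by simp)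
  have hsplit : (x ++ [(j, m)]) ++ (i, m) :: (i, j) :: y =
    x ++ [(j, m), (i, m), (i, j)] ++ y := by simp
  have hnd := h.nodup
  rw [hsplit] at hnd ⊢
  refine ⟨_, ⟨x, _, y, i, j, m, hij.1, hjm, Or.inr rfl, rfl, rfl⟩, ?_⟩
  refine reversals_reverse_factor_lt (m := [(j, m), (i, m), (i, j)]) (e₀ := ((i, j), (j, m))) hnd
    (fun e => eq_of_mem_triples hij.1 hjm (Or.inr rfl)) (mem_triples.2 (by omega)) (by simp)
    (by simp) ?_
  exact (before_append_cons_left (x := [(j, m), (i, m)]) (by simp; omega)).2 (by simp)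

end Descent

theorem exists_lowering_move (h : IsConvexOrder n l)
    (hne : ¬ (reversals (triples n) l = 0 ∧ reversals (quadruples n) l = 0)) :
    ∃ l', (PairCommMove l l' ∧ reversals (quadruples n) l' < reversals (quadruples n) l) ∨
      (PairBraidMove l l' ∧ reversals (triples n) l' < reversals (triples n) l) := by
  rcases pairwise_or_exists_descent Prod.snd l with hs | ⟨x, ⟨k, m⟩, ⟨i, j⟩, y, rfl, hs, hjm⟩
  · exact absurd (h.reversals_eq_zero_of_pairwise hs) hne
  · rcases eq_or_ne k i with rfl | hki
    · exact (h.exists_pairBraidMove_of_descent hs hjm).imp fun l' => Or.inr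
    · exact (h.exists_pairCommMove_of_descent hjm hki (h.ne_of_descent hjm)).imp fun l' => Or.inl

theorem before_of_reversals_triples_eq_zero (h : IsConvexOrder n l)
    (h₃ : reversals (triples n) l = 0) {a b c : ℕ} (hab : a < b) (hbc : b < c) (hc : c < n) :
    Before l (a, b) (a, c) ∧ Before l (a, c) (b, c) :=
  (h.convex a b c hab hbc hc).resolve_right fun hconv =>
    reversals_eq_zero_iff.1 h₃ ((a, b), (b, c)) (mem_triples.2 (by omega))
      (hconv.1.trans hconv.2)

theorem pairwise_of_reversals_eq_zero (h : IsConvexOrder n l)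
    (h₃ : reversals (triples n) l = 0) (h₄ : reversals (quadruples n) l = 0) :
    l.Pairwise fun p q => p.2 < q.2 ∨ p.2 = q.2 ∧ p.1 < q.1 := by
  refine pairwise_of_forall_before h.nodup ?_
  rintro ⟨c, d⟩ hcd ⟨a, b⟩ hab hb
  by_contra hlex
  simp only at hlex
  have hcd := h.lt_and_lt_of_mem hcd
  have hab := h.lt_and_lt_of_mem hab
  have hne : ¬ (a = c ∧ b = d) := by
    rintro ⟨rfl, rfl⟩
    exact hb.asymm hb
  by_cases hdis : b < d ∧ a ≠ c ∧ b ≠ c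
  · exact reversals_eq_zero_iff.1 h₄ ((a, b), (c, d)) (mem_quadruples.2 (by omega)) hb
  · refine hb.asymm ?_
    have hzero {a b c : ℕ} := h.before_of_reversals_triples_eq_zero h₃ (a := a) (b := b) (c := c)
    obtain ⟨rfl, hbd⟩ | ⟨rfl, hbd⟩ | ⟨rfl, hac⟩ :
      (a = c ∧ b < d) ∨ (b = c ∧ b < d) ∨ (b = d ∧ a < c) := by omega
    · exact (hzero hab.1 hbd hcd.2).1
    · have := hzero hab.1 hbd hcd.2
      exact this.1.trans this.2
    · exact (hzero hac hcd.1 hcd.2).2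

theorem eq_of_reversals_eq_zero (h : IsConvexOrder n l) (h' : IsConvexOrder n l')
    (h₃ : reversals (triples n) l = 0) (h₄ : reversals (quadruples n) l = 0)
    (h₃' : reversals (triples n) l' = 0) (h₄' : reversals (quadruples n) l' = 0) : l = l' := by
  refine ((List.perm_ext_iff_of_nodup h.nodup h'.nodup).2 fun p => ?_).eq_of_pairwise
    (fun p q _ _ hpq hqp => ?_) (h.pairwise_of_reversals_eq_zero h₃ h₄)
    (h'.pairwise_of_reversals_eq_zero h₃' h₄')
  · rw [h.mem_iff, h'.mem_iff]
  · omega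

end IsConvexOrder

section Words

variable {n : ℕ}

/-- The left one of the two adjacent positions exchanged by the letter `i`. -/
def leftPos (i : Fin (n - 1)) : Fin n := ⟨i.1, by omega⟩

/-- The right one of the two adjacent positions exchanged by the letter `i`. -/
def rightPos (i : Fin (n - 1)) : Fin n := ⟨i.1 + 1, by omega⟩

theorem leftPos_lt_rightPos (i : Fin (n - 1)) : leftPos i < rightPos i :=
  Nat.lt_succ_self i.1

theorem leftPos_injective : Function.Injective (leftPos : Fin (n - 1) → Fin n) :=
  fun _ _ h => Fin.ext (Fin.mk.inj h)

theorem perm_inv_apply_self (σ : Equiv.Perm (Fin n)) (a : Fin n) : σ⁻¹ (σ a) = a :=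
  σ.symm_apply_apply a

theorem simpleReflection_eq_swap (i : Fin (n - 1)) :
    simpleReflection i = Equiv.swap (leftPos i) (rightPos i) := rfl

theorem mul_simpleReflection (σ : Equiv.Perm (Fin n)) (i : Fin (n - 1)) :
    σ * simpleReflection i = Equiv.swap (σ (leftPos i)) (σ (rightPos i)) * σ :=
  Equiv.mul_swap_eq_swap_mul σ (leftPos i) (rightPos i)

theorem simpleReflection_mul_self (i : Fin (n - 1)) :
    simpleReflection i * simpleReflection i = 1 :=
  Equiv.swap_mul_self _ _

theorem wordProd_nil : wordProd ([] : List (Fin (n - 1))) = 1 := rfl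

theorem wordProd_cons (i : Fin (n - 1)) (w : List (Fin (n - 1))) :
    wordProd (i :: w) = simpleReflection i * wordProd w :=
  List.prod_cons

theorem wordProd_append (u v : List (Fin (n - 1))) :
    wordProd (u ++ v) = wordProd u * wordProd v := by
  rw [wordProd, List.map_append, List.prod_append, wordProd, wordProd]

theorem exists_isReducedWord (π : Equiv.Perm (Fin n)) : ∃ w, IsReducedWord π w := by
  have hne : {w : List (Fin (n - 1)) | wordProd w = π}.Nonempty := by
    cases n with
    | zero => exact ⟨[], Subsingleton.elim _ _⟩
    | succ n =>
      have hπ : π ∈ Submonoid.closure (Set.range (simpleReflection (n := n + 1))) :=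
        (Equiv.Perm.mclosure_swap_castSucc_succ n).symm ▸ Submonoid.mem_top π
      induction hπ using Submonoid.closure_induction_left with
      | one => exact ⟨[], wordProd_nil⟩
      | mul_left s hs π _ ih =>
        obtain ⟨i, rfl⟩ := hs
        obtain ⟨w, rfl⟩ := ih
        exact ⟨i :: w, wordProd_cons i w⟩
  obtain ⟨w, hw, hmin⟩ := (measure List.length).wf.has_min _ hne
  exact ⟨w, hw, fun v hv => not_lt.1 (hmin v hv)⟩

theorem IsReducedWord.of_append {π : Equiv.Perm (Fin n)} {u v : List (Fin (n - 1))}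
    (h : IsReducedWord π (u ++ v)) : IsReducedWord (wordProd u) u := by
  refine ⟨rfl, fun u' hu' => ?_⟩
  have := h.2 (u' ++ v) (by rw [← h.1, wordProd_append, wordProd_append, hu'])
  simpa only [List.length_append, add_le_add_iff_right] using this

/-- The pairs of values that are exchanged when the letters of a word are applied to the
positions, one after the other, starting with the arrangement `σ`. Each pair lists the value on
the left before the value on the right. -/
def crossings (σ : Equiv.Perm (Fin n)) : List (Fin (n - 1)) → List (ℕ × ℕ)
  | [] => []
  | i :: w => ((σ (leftPos i)).1, (σ (rightPos i)).1) :: crossings (σ * simpleReflection i) w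

theorem crossings_append (σ : Equiv.Perm (Fin n)) (u v : List (Fin (n - 1))) :
    crossings σ (u ++ v) = crossings σ u ++ crossings (σ * wordProd u) v := by
  induction u generalizing σ with
  | nil => rfl
  | cons i u ih => rw [List.cons_append, crossings, ih, wordProd_cons, ← mul_assoc]; rfl

theorem length_crossings (σ : Equiv.Perm (Fin n)) (w : List (Fin (n - 1))) :
    (crossings σ w).length = w.length := by
  induction w generalizing σ with
  | nil => rfl
  | cons i w ih => rw [crossings, List.length_cons, ih, List.length_cons]

theorem crossings_injective (σ : Equiv.Perm (Fin n)) : Function.Injective (crossings σ) := by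
  intro u v h
  induction u generalizing σ v with
  | nil => exact (List.length_eq_zero_iff.1 (by rw [← length_crossings σ, ← h]; rfl)).symm
  | cons i u ih =>
    cases v with
    | nil => exact absurd h (List.cons_ne_nil _ _)
    | cons j v =>
      obtain ⟨hp, h⟩ := List.cons.inj h
      obtain rfl := leftPos_injective (σ.injective (Fin.ext (congrArg Prod.fst hp)))
      rw [ih _ h]

theorem exists_of_crossings_eq_append {σ : Equiv.Perm (Fin n)} {w : List (Fin (n - 1))}
    {x y : List (ℕ × ℕ)} (h : crossings σ w = x ++ y) :
    ∃ u v, w = u ++ v ∧ crossings σ u = x ∧ crossings (σ * wordProd u) v = y := by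
  have hlen := congrArg List.length h
  rw [length_crossings, List.length_append] at hlen
  refine ⟨w.take x.length, w.drop x.length, (List.take_append_drop _ _).symm, ?_⟩
  rw [← List.take_append_drop x.length w, crossings_append] at h
  refine List.append_inj h ?_
  rw [length_crossings, List.length_take]
  omega

theorem exists_of_crossings_eq_cons {σ : Equiv.Perm (Fin n)} {w : List (Fin (n - 1))}
    {p : ℕ × ℕ} {y : List (ℕ × ℕ)} (h : crossings σ w = p :: y) :
    ∃ i v, w = i :: v ∧ ((σ (leftPos i)).1, (σ (rightPos i)).1) = p ∧
      crossings (σ * simpleReflection i) v = y := by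
  cases w with
  | nil => exact absurd h.symm (List.cons_ne_nil _ _)
  | cons i v => exact ⟨i, v, rfl, List.cons.inj h⟩

theorem exists_fin_of_mem_crossings {σ : Equiv.Perm (Fin n)} {w : List (Fin (n - 1))} {p : ℕ × ℕ}
    (h : p ∈ crossings σ w) : ∃ a b : Fin n, p = (a.1, b.1) := by
  obtain ⟨x, y, h⟩ := List.append_of_mem h
  obtain ⟨u, v, -, -, hv⟩ := exists_of_crossings_eq_append h
  obtain ⟨i, -, -, hi, -⟩ := exists_of_crossings_eq_cons hv
  exact ⟨_, _, hi.symm⟩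

/-- The strong exchange condition. -/
theorem exists_swap_mul_eq_mul_wordProd {σ : Equiv.Perm (Fin n)} {w : List (Fin (n - 1))}
    {a b : Fin n} (h : (a.1, b.1) ∈ crossings σ w) :
    ∃ v, v.length < w.length ∧ Equiv.swap a b * (σ * wordProd w) = σ * wordProd v := by
  induction w generalizing σ with
  | nil => exact absurd h List.not_mem_nil
  | cons i w ih =>
    rw [wordProd_cons, ← mul_assoc σ]
    rcases List.mem_cons.1 h with hi | h
    · refine ⟨w, Nat.lt_succ_self _, ?_⟩
      obtain ⟨ha, hb⟩ := Prod.mk.inj hi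
      rw [Fin.ext ha, Fin.ext hb, ← mul_assoc, ← mul_assoc, ← mul_simpleReflection, mul_assoc σ,
        simpleReflection_mul_self, mul_one]
    · obtain ⟨v, hv, hmul⟩ := ih h
      exact ⟨i :: v, Nat.succ_lt_succ hv, by rw [hmul, wordProd_cons, mul_assoc]⟩

theorem IsReducedWord.notMem_crossings {π : Equiv.Perm (Fin n)} {u : List (Fin (n - 1))}
    {i : Fin (n - 1)} (h : IsReducedWord π (u ++ [i])) {a b : Fin n}
    (hab : Equiv.swap a b = Equiv.swap (wordProd u (leftPos i)) (wordProd u (rightPos i))) :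
    (a.1, b.1) ∉ crossings 1 u := by
  intro hu
  obtain ⟨v, hv, hmul⟩ := exists_swap_mul_eq_mul_wordProd hu
  rw [hab, one_mul, one_mul, ← mul_simpleReflection] at hmul
  have hlen := h.2 v (by rw [← hmul, ← h.1, wordProd_append, wordProd_cons, wordProd_nil, mul_one])
  rw [List.length_append] at hlen
  omega

theorem inv_mul_simpleReflection_lt_iff (σ : Equiv.Perm (Fin n)) (i : Fin (n - 1)) {a b : Fin n}
    (h₁ : (a, b) ≠ (σ (leftPos i), σ (rightPos i)))
    (h₂ : (b, a) ≠ (σ (leftPos i), σ (rightPos i))) :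
    (σ * simpleReflection i)⁻¹ a < (σ * simpleReflection i)⁻¹ b ↔ σ⁻¹ a < σ⁻¹ b := by
  obtain ⟨a, rfl⟩ := σ.surjective a
  obtain ⟨b, rfl⟩ := σ.surjective b
  simp only [ne_eq, Prod.mk.injEq, σ.injective.eq_iff] at h₁ h₂
  rw [mul_inv_rev, simpleReflection_eq_swap, Equiv.swap_inv]
  simp only [Equiv.Perm.mul_apply, perm_inv_apply_self, Equiv.swap_apply_def, leftPos,
    rightPos, Fin.ext_iff, Fin.lt_def] at *
  split_ifs <;> simp only <;> omega

theorem inv_lt_inv_iff_of_notMem_crossings {σ : Equiv.Perm (Fin n)} {w : List (Fin (n - 1))}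
    {a b : Fin n} (h₁ : (a.1, b.1) ∉ crossings σ w) (h₂ : (b.1, a.1) ∉ crossings σ w) :
    (σ * wordProd w)⁻¹ a < (σ * wordProd w)⁻¹ b ↔ σ⁻¹ a < σ⁻¹ b := by
  induction w generalizing σ with
  | nil => rw [wordProd_nil, mul_one]
  | cons i w ih =>
    obtain ⟨hi₁, h₁⟩ := not_or.1 (List.mem_cons.not.1 h₁)
    obtain ⟨hi₂, h₂⟩ := not_or.1 (List.mem_cons.not.1 h₂)
    rw [wordProd_cons, ← mul_assoc, ih h₁ h₂]
    exact inv_mul_simpleReflection_lt_iff σ i (mt (congrArg (Prod.map Fin.val Fin.val)) hi₁)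
      (mt (congrArg (Prod.map Fin.val Fin.val)) hi₂)

theorem inv_mul_simpleReflection_apply_lt (σ : Equiv.Perm (Fin n)) (i : Fin (n - 1)) :
    (σ * simpleReflection i)⁻¹ (σ (rightPos i)) < (σ * simpleReflection i)⁻¹ (σ (leftPos i)) := by
  rw [mul_inv_rev, simpleReflection_eq_swap, Equiv.swap_inv, Equiv.Perm.mul_apply,
    Equiv.Perm.mul_apply, perm_inv_apply_self, perm_inv_apply_self,
    Equiv.swap_apply_left, Equiv.swap_apply_right]
  exact leftPos_lt_rightPos i

/-- In every crossing the smaller value is on the left. -/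
def Ascending (l : List (ℕ × ℕ)) : Prop := ∀ p ∈ l, p.1 < p.2

theorem IsReducedWord.ascending_and_nodup {π : Equiv.Perm (Fin n)} {w : List (Fin (n - 1))}
    (hw : IsReducedWord π w) : Ascending (crossings 1 w) ∧ (crossings 1 w).Nodup := by
  induction w using List.reverseRecOn generalizing π with
  | nil => exact ⟨fun _ h => absurd h List.not_mem_nil, List.nodup_nil⟩
  | append_singleton u i ih =>
    obtain ⟨hasc, hnd⟩ := ih hw.of_append
    rw [crossings_append, one_mul]
    set a := wordProd u (leftPos i) with ha
    set b := wordProd u (rightPos i) with hb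
    have hab : (a.1, b.1) ∉ crossings 1 u := hw.notMem_crossings rfl
    have hba : (b.1, a.1) ∉ crossings 1 u := hw.notMem_crossings (Equiv.swap_comm _ _)
    have hlt : a < b := by
      have := inv_lt_inv_iff_of_notMem_crossings hab hba
      rw [one_mul, ha, hb, perm_inv_apply_self, perm_inv_apply_self] at this
      simpa using this.1 (leftPos_lt_rightPos i)
    constructor
    · intro p hp
      rcases List.mem_append.1 hp with hp | hp
      · exact hasc p hp
      · rw [List.mem_singleton.1 hp]
        exact hlt
    · exact hnd.append (List.nodup_singleton _) (List.disjoint_singleton.2 hab)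

theorem inv_lt_inv_iff_mem_crossings {σ : Equiv.Perm (Fin n)} {w : List (Fin (n - 1))}
    (hw : Ascending (crossings σ w)) {a b : Fin n} (hab : a < b) :
    (σ * wordProd w)⁻¹ b < (σ * wordProd w)⁻¹ a ↔
      (a.1, b.1) ∈ crossings σ w ∨ σ⁻¹ b < σ⁻¹ a := by
  induction w generalizing σ with
  | nil => simp [wordProd_nil, crossings]
  | cons i w ih =>
    rw [wordProd_cons, ← mul_assoc, ih fun p hp => hw p (List.mem_cons_of_mem _ hp), crossings,
      List.mem_cons]
    by_cases hi : (a, b) = (σ (leftPos i), σ (rightPos i))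
    · obtain ⟨rfl, rfl⟩ := Prod.mk.inj hi
      exact iff_of_true (Or.inr (inv_mul_simpleReflection_apply_lt σ i)) (Or.inl (Or.inl rfl))
    · have hi' : (b, a) ≠ (σ (leftPos i), σ (rightPos i)) := by
        intro h
        have := hw _ List.mem_cons_self
        rw [← (Prod.mk.inj h).1, ← (Prod.mk.inj h).2] at this
        exact hab.asymm this
      rw [inv_mul_simpleReflection_lt_iff σ i hi' hi]
      simp only [Prod.mk.injEq, Fin.val_inj] at hi ⊢
      tauto

theorem longest_inv_lt_iff {a b : Fin n} : (longest n)⁻¹ a < (longest n)⁻¹ b ↔ b < a :=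
  Fin.rev_lt_rev

theorem mem_crossings_iff {w : List (Fin (n - 1))} (hw : IsReducedWord (longest n) w)
    (p : ℕ × ℕ) : p ∈ crossings 1 w ↔ p ∈ pairs n := by
  have hasc := hw.ascending_and_nodup.1
  constructor
  · intro hp
    obtain ⟨a, b, rfl⟩ := exists_fin_of_mem_crossings hp
    exact mem_pairs.2 ⟨hasc _ hp, b.2⟩
  · obtain ⟨a, b⟩ := p
    intro hp
    obtain ⟨hab, hb⟩ := mem_pairs.1 hp
    have hab' : (⟨a, hab.trans hb⟩ : Fin n) < ⟨b, hb⟩ := hab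
    have := inv_lt_inv_iff_mem_crossings hasc hab'
    rw [one_mul, hw.1, longest_inv_lt_iff] at this
    exact (this.1 hab').resolve_right (by simpa using hab.le)

/-- When the values `a` and `c` cross, they are adjacent, so a value `b` between them has crossed
exactly one of them. -/
theorem IsReducedWord.mem_iff_notMem_of_crossings_eq {π : Equiv.Perm (Fin n)}
    {w : List (Fin (n - 1))} (hw : IsReducedWord π w) {x y : List (ℕ × ℕ)} {a b c : ℕ}
    (h : crossings 1 w = x ++ (a, c) :: y) (hab : a < b) (hbc : b < c) :
    (a, b) ∈ x ↔ (b, c) ∉ x := by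
  obtain ⟨u, v, rfl, rfl, hv⟩ := exists_of_crossings_eq_append h
  obtain ⟨i, v, rfl, hi, -⟩ := exists_of_crossings_eq_cons hv
  have hasc := hw.of_append.ascending_and_nodup.1
  obtain ⟨rfl, rfl⟩ := Prod.mk.inj hi
  rw [one_mul] at *
  obtain ⟨k, hk⟩ := (wordProd u).surjective ⟨b, hbc.trans (Fin.is_lt _)⟩
  obtain rfl : (wordProd u k).1 = b := congrArg Fin.val hk
  have hl := inv_lt_inv_iff_mem_crossings hasc (a := wordProd u (leftPos i)) hab
  have hr := inv_lt_inv_iff_mem_crossings hasc (b := wordProd u (rightPos i)) hbc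
  rw [one_mul, perm_inv_apply_self, perm_inv_apply_self, inv_one, Equiv.Perm.one_apply,
    Equiv.Perm.one_apply, or_iff_left (lt_asymm (by assumption))] at hl hr
  have hkl : k ≠ leftPos i := by rintro rfl; exact hab.false
  have hkr : k ≠ rightPos i := by rintro rfl; exact hbc.false
  rw [← hl, ← hr]
  simp only [ne_eq, leftPos, rightPos, Fin.ext_iff, Fin.lt_def] at *
  omega

theorem isConvexOrder_crossings {w : List (Fin (n - 1))} (hw : IsReducedWord (longest n) w) :
    IsConvexOrder n (crossings 1 w) where
  nodup := hw.ascending_and_nodup.2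
  mem_iff := mem_crossings_iff hw
  convex a b c hab hbc hc := by
    have hac : (a, c) ∈ crossings 1 w :=
      (mem_crossings_iff hw _).2 (mem_pairs.2 ⟨hab.trans hbc, hc⟩)
    obtain ⟨x, y, h⟩ := List.append_of_mem hac
    have hx := notMem_of_nodup_append_cons (h ▸ hw.ascending_and_nodup.2)
    have hconv := hw.mem_iff_notMem_of_crossings_eq h hab hbc
    rw [h, before_append_cons_left hx, before_append_cons_left hx,
      before_append_cons_right hx (by simp; omega), before_append_cons_right hx (by simp; omega)]
    tauto

end Words

section Moves

variable {n : ℕ} {i j k : Fin (n - 1)}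

theorem simpleReflection_leftPos (i : Fin (n - 1)) :
    simpleReflection i (leftPos i) = rightPos i :=
  Equiv.swap_apply_left _ _

theorem simpleReflection_rightPos (i : Fin (n - 1)) :
    simpleReflection i (rightPos i) = leftPos i :=
  Equiv.swap_apply_right _ _

theorem simpleReflection_apply_of_ne {a : Fin n} (hl : a.1 ≠ i.1) (hr : a.1 ≠ i.1 + 1) :
    simpleReflection i a = a :=
  Equiv.swap_apply_of_ne_of_ne (Fin.ne_of_val_ne hl) (Fin.ne_of_val_ne hr)

theorem simpleReflection_leftPos_of_ne (hl : k.1 ≠ j.1) (hr : k.1 ≠ j.1 + 1) :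
    simpleReflection j (leftPos k) = leftPos k :=
  simpleReflection_apply_of_ne hl hr

theorem simpleReflection_rightPos_of_ne (hl : k.1 + 1 ≠ j.1) (hr : k.1 ≠ j.1) :
    simpleReflection j (rightPos k) = rightPos k :=
  simpleReflection_apply_of_ne hl (mt Nat.succ.inj hr)

theorem crossings_pair_of_far (σ : Equiv.Perm (Fin n)) (h : j.1 + 1 < k.1 ∨ k.1 + 1 < j.1) :
    crossings σ [j, k] =
      [((σ (leftPos j)).1, (σ (rightPos j)).1), ((σ (leftPos k)).1, (σ (rightPos k)).1)] := by
  simp only [crossings, Equiv.Perm.mul_apply]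
  rw [simpleReflection_leftPos_of_ne (by omega) (by omega),
    simpleReflection_rightPos_of_ne (by omega) (by omega)]

theorem wordProd_pair_comm_of_far (h : j.1 + 1 < k.1 ∨ k.1 + 1 < j.1) :
    wordProd [k, j] = wordProd [j, k] := by
  simp only [wordProd_cons, wordProd_nil, mul_one]
  rw [mul_simpleReflection, simpleReflection_leftPos_of_ne (by omega) (by omega),
    simpleReflection_rightPos_of_ne (by omega) (by omega), simpleReflection_eq_swap j]

theorem leftPos_eq_rightPos (h : k.1 = j.1 + 1) : leftPos k = rightPos j :=
  Fin.ext h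

theorem simpleReflection_rightPos_of_succ (h : k.1 = j.1 + 1) :
    simpleReflection k (rightPos j) = rightPos k := by
  rw [← leftPos_eq_rightPos h, simpleReflection_leftPos]

theorem crossings_up (σ : Equiv.Perm (Fin n)) (h : k.1 = j.1 + 1) :
    crossings σ [j, k, j] = [((σ (leftPos j)).1, (σ (rightPos j)).1),
      ((σ (leftPos j)).1, (σ (rightPos k)).1), ((σ (rightPos j)).1, (σ (rightPos k)).1)] := by
  have hjk : simpleReflection j (rightPos k) = rightPos k :=
    simpleReflection_rightPos_of_ne (by omega) (by omega)
  have hkj : simpleReflection k (leftPos j) = leftPos j :=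
    simpleReflection_leftPos_of_ne (by omega) (by omega)
  simp only [crossings, Equiv.Perm.mul_apply, leftPos_eq_rightPos h, hjk, hkj,
    simpleReflection_rightPos_of_succ h, simpleReflection_leftPos, simpleReflection_rightPos]

theorem crossings_down (σ : Equiv.Perm (Fin n)) (h : k.1 = j.1 + 1) :
    crossings σ [k, j, k] = [((σ (rightPos j)).1, (σ (rightPos k)).1),
      ((σ (leftPos j)).1, (σ (rightPos k)).1), ((σ (leftPos j)).1, (σ (rightPos j)).1)] := by
  have hjk : simpleReflection j (rightPos k) = rightPos k :=
    simpleReflection_rightPos_of_ne (by omega) (by omega)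
  have hkj : simpleReflection k (leftPos j) = leftPos j :=
    simpleReflection_leftPos_of_ne (by omega) (by omega)
  have hkl : simpleReflection k (rightPos k) = rightPos j := by
    rw [simpleReflection_rightPos, leftPos_eq_rightPos h]
  simp only [crossings, Equiv.Perm.mul_apply, leftPos_eq_rightPos h, hjk, hkj, hkl,
    simpleReflection_rightPos_of_succ h, simpleReflection_rightPos]

theorem wordProd_up_eq_down (h : k.1 = j.1 + 1) : wordProd [j, k, j] = wordProd [k, j, k] := by
  have hl : (simpleReflection j * simpleReflection k) (leftPos j) = leftPos k := by
    rw [Equiv.Perm.mul_apply, simpleReflection_leftPos_of_ne (by omega) (by omega),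
      simpleReflection_leftPos, leftPos_eq_rightPos h]
  have hr : (simpleReflection j * simpleReflection k) (rightPos j) = rightPos k := by
    rw [Equiv.Perm.mul_apply, simpleReflection_rightPos_of_succ h,
      simpleReflection_rightPos_of_ne (by omega) (by omega)]
  simp only [wordProd_cons, wordProd_nil, mul_one]
  rw [← mul_assoc, mul_simpleReflection, hl, hr, simpleReflection_eq_swap k]

theorem crossings_braid (σ : Equiv.Perm (Fin n)) (h : k.1 = j.1 + 1 ∨ j.1 = k.1 + 1) :
    crossings σ [k, j, k] = (crossings σ [j, k, j]).reverse := by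
  rcases h with h | h <;> rw [crossings_up _ h, crossings_down _ h] <;> rfl

theorem wordProd_braid (h : k.1 = j.1 + 1 ∨ j.1 = k.1 + 1) :
    wordProd [k, j, k] = wordProd [j, k, j] :=
  h.elim (fun h => (wordProd_up_eq_down h).symm) wordProd_up_eq_down

theorem crossings_pair_comm_of_far (σ : Equiv.Perm (Fin n))
    (h : j.1 + 1 < k.1 ∨ k.1 + 1 < j.1) :
    crossings σ [k, j] = (crossings σ [j, k]).reverse := by
  rw [crossings_pair_of_far _ h, crossings_pair_of_far _ h.symm]
  rfl

theorem crossings_append_append (σ : Equiv.Perm (Fin n)) (x s y : List (Fin (n - 1))) :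
    crossings σ (x ++ s ++ y) = crossings σ x ++ crossings (σ * wordProd x) s ++
      crossings (σ * wordProd x * wordProd s) y := by
  rw [crossings_append, crossings_append, wordProd_append, mul_assoc]

theorem IsReducedWord.of_wordProd_eq {π : Equiv.Perm (Fin n)} {x s t y : List (Fin (n - 1))}
    (h : IsReducedWord π (x ++ s ++ y)) (hprod : wordProd t = wordProd s)
    (hlen : t.length = s.length) : IsReducedWord π (x ++ t ++ y) := by
  refine ⟨by rw [← h.1]; simp only [wordProd_append, hprod], fun v hv => ?_⟩
  have := h.2 v hv
  simpa only [List.length_append, hlen] using this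

theorem CommMove.isReducedWord {π : Equiv.Perm (Fin n)} {u v : List (Fin (n - 1))}
    (h : CommMove u v) (hu : IsReducedWord π u) : IsReducedWord π v := by
  obtain ⟨x, y, j, k, hjk, rfl, rfl⟩ := h
  exact hu.of_wordProd_eq (wordProd_pair_comm_of_far hjk) rfl

theorem BraidMove.isReducedWord {π : Equiv.Perm (Fin n)} {u v : List (Fin (n - 1))}
    (h : BraidMove u v) (hu : IsReducedWord π u) : IsReducedWord π v := by
  obtain ⟨x, y, j, k, hjk, rfl, rfl⟩ := h
  exact hu.of_wordProd_eq (wordProd_braid hjk) rfl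

theorem CommMove.pairCommMove {u v : List (Fin (n - 1))} (h : CommMove u v) :
    PairCommMove (crossings 1 u) (crossings 1 v) := by
  obtain ⟨x, y, j, k, hjk, rfl, rfl⟩ := h
  rw [crossings_append_append, crossings_append_append, wordProd_pair_comm_of_far hjk,
    crossings_pair_of_far _ hjk, crossings_pair_of_far _ hjk.symm]
  refine ⟨_, _, _, _, ?_, rfl, rfl⟩
  simp only [ne_eq, Fin.val_inj, EmbeddingLike.apply_eq_iff_eq, leftPos, rightPos, Fin.mk.injEq]
  omega

theorem BraidMove.pairBraidMove {u v : List (Fin (n - 1))} (h : BraidMove u v)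
    (hu : Ascending (crossings 1 u)) : PairBraidMove (crossings 1 u) (crossings 1 v) := by
  obtain ⟨x, y, j, k, hjk, rfl, rfl⟩ := h
  rw [crossings_append_append] at hu
  rw [crossings_append_append, crossings_append_append, wordProd_braid hjk, crossings_braid _ hjk]
  rcases hjk with hjk | hjk
  · rw [crossings_up _ hjk] at hu ⊢
    exact ⟨_, _, _, _, _, _, hu (_, _) (by simp), hu (_, _) (by simp), Or.inl rfl, rfl, rfl⟩
  · rw [crossings_down _ hjk] at hu ⊢
    exact ⟨_, _, _, _, _, _, hu (_, _) (by simp), hu (_, _) (by simp), Or.inr rfl, rfl, rfl⟩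

theorem far_of_crossings_eq {σ : Equiv.Perm (Fin n)} {p q : ℕ × ℕ}
    (h : crossings σ [j, k] = [p, q])
    (hpq : p.1 ≠ q.1 ∧ p.1 ≠ q.2 ∧ p.2 ≠ q.1 ∧ p.2 ≠ q.2) :
    j.1 + 1 < k.1 ∨ k.1 + 1 < j.1 := by
  simp only [crossings, List.cons.injEq, and_true] at h
  obtain ⟨rfl, rfl⟩ := h
  simp only [Equiv.Perm.mul_apply, ne_eq, Fin.val_inj, σ.injective.eq_iff] at hpq
  simp only [simpleReflection_eq_swap, Equiv.swap_apply_def, leftPos, rightPos,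
    Fin.ext_iff] at hpq
  by_contra hjk
  obtain h | h | h : k.1 = j.1 ∨ k.1 = j.1 + 1 ∨ j.1 = k.1 + 1 := by omega
  all_goals simp [h] at hpq

theorem adjacent_of_crossings_eq {σ : Equiv.Perm (Fin n)} {a b c : ℕ}
    (h : crossings σ [i, j, k] = [(a, b), (a, c), (b, c)] ∨
      crossings σ [i, j, k] = [(b, c), (a, c), (a, b)]) :
    (j.1 = i.1 + 1 ∨ i.1 = j.1 + 1) ∧ k = i := by
  simp only [crossings, List.cons.injEq, Prod.mk.injEq, and_true] at h
  rcases h with ⟨⟨rfl, rfl⟩, ⟨h₁, rfl⟩, h₂, -⟩ | ⟨⟨rfl, rfl⟩, ⟨rfl, h₁⟩, h₂, -⟩ <;>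
  · simp only [Fin.val_inj, Equiv.Perm.mul_apply, σ.injective.eq_iff] at h₁ h₂
    simp only [simpleReflection_eq_swap, Equiv.swap_apply_def, leftPos, rightPos, Fin.ext_iff] at *
    split_ifs at * <;> simp only at * <;> omega

theorem exists_of_crossings_eq_append_append {σ : Equiv.Perm (Fin n)} {w : List (Fin (n - 1))}
    {x m y : List (ℕ × ℕ)} (h : crossings σ w = x ++ m ++ y) :
    ∃ u s v, w = u ++ s ++ v ∧ crossings σ u = x ∧ crossings (σ * wordProd u) s = m ∧
      crossings (σ * wordProd u * wordProd s) v = y := by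
  obtain ⟨us, v, rfl, hus, hv⟩ := exists_of_crossings_eq_append h
  obtain ⟨u, s, rfl, hu, hs⟩ := exists_of_crossings_eq_append hus
  exact ⟨u, s, v, rfl, hu, hs, by rw [← hv, wordProd_append, mul_assoc]⟩

theorem exists_commMove {w : List (Fin (n - 1))} {l : List (ℕ × ℕ)}
    (h : PairCommMove (crossings 1 w) l) : ∃ w', CommMove w w' ∧ crossings 1 w' = l := by
  obtain ⟨x, y, p, q, hpq, hw, rfl⟩ := h
  obtain ⟨u, s, v, rfl, rfl, hs, rfl⟩ := exists_of_crossings_eq_append_append hw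
  obtain ⟨j, k, rfl⟩ := List.length_eq_two.1 (by rw [← length_crossings, hs]; rfl)
  have hjk := far_of_crossings_eq hs hpq
  refine ⟨_, ⟨u, v, j, k, hjk, rfl, rfl⟩, ?_⟩
  rw [crossings_append_append, wordProd_pair_comm_of_far hjk, crossings_pair_comm_of_far _ hjk, hs]
  rfl

theorem exists_braidMove {w : List (Fin (n - 1))} {l : List (ℕ × ℕ)}
    (h : PairBraidMove (crossings 1 w) l) : ∃ w', BraidMove w w' ∧ crossings 1 w' = l := by
  obtain ⟨x, m, y, a, b, c, -, -, hm, hw, rfl⟩ := h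
  obtain ⟨u, s, v, rfl, rfl, rfl, rfl⟩ := exists_of_crossings_eq_append_append hw
  obtain ⟨i, j, k, rfl⟩ := List.length_eq_three.1
    (by rw [← length_crossings]; rcases hm with hm | hm <;> rw [hm] <;> rfl)
  obtain ⟨hij, rfl⟩ := adjacent_of_crossings_eq hm
  refine ⟨_, ⟨u, v, k, j, hij, rfl, rfl⟩, ?_⟩
  rw [crossings_append_append, wordProd_braid hij, crossings_braid _ hij]

end Moves

section Graphs

variable {V W : Type*}

theorem le_add_length_of_walk {G : SimpleGraph V} {φ : V → ℕ}
    (lip : ∀ u v, G.Adj u v → φ v ≤ φ u + 1) {u v : V} (p : G.Walk u v) :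
    φ v ≤ φ u + p.length := by
  induction p with
  | nil => exact le_rfl
  | cons h p ih =>
    have := lip _ _ h
    rw [SimpleGraph.Walk.length_cons]
    omega

/-- Either the path from `u` to `v` through `r₀` or the one through `r₁` is short, since the sum of
their lengths is at most `2 * N`. -/
theorem ediam_le_of_edist_le {G : SimpleGraph V} {φ : V → ℕ} {N : ℕ} {r₀ r₁ : V}
    (hle : ∀ u, φ u ≤ N) (h₀ : ∀ u, G.edist u r₀ ≤ φ u)
    (h₁ : ∀ u, G.edist u r₁ ≤ (N - φ u : ℕ)) : G.ediam ≤ N := by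
  refine SimpleGraph.ediam_le_of_edist_le fun u v => ?_
  rcases le_total (φ u + φ v) N with h | h
  · calc G.edist u v ≤ G.edist u r₀ + G.edist r₀ v := SimpleGraph.edist_triangle
      _ ≤ φ u + φ v := add_le_add (h₀ u) (SimpleGraph.edist_comm.trans_le (h₀ v))
      _ ≤ N := by exact_mod_cast h
  · calc G.edist u v ≤ G.edist u r₁ + G.edist r₁ v := SimpleGraph.edist_triangle
      _ ≤ (N - φ u : ℕ) + (N - φ v : ℕ) :=
        add_le_add (h₁ u) (SimpleGraph.edist_comm.trans_le (h₁ v))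
      _ ≤ N := by
        have := hle u
        have := hle v
        norm_cast
        omega

theorem connected_and_diam_eq_of_potential {G : SimpleGraph V} {φ : V → ℕ} {N : ℕ} {r₀ r₁ : V}
    (hle : ∀ u, φ u ≤ N) (hr₀ : φ r₀ = 0) (hr₁ : φ r₁ = N)
    (lip : ∀ u v, G.Adj u v → φ v ≤ φ u + 1) (h₀ : ∀ u, G.edist u r₀ ≤ φ u)
    (h₁ : ∀ u, G.edist u r₁ ≤ (N - φ u : ℕ)) : G.Connected ∧ G.diam = N := by
  have upper : G.ediam ≤ N := ediam_le_of_edist_le hle h₀ h₁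
  have htop : G.ediam ≠ ⊤ := ne_top_of_le_ne_top (ENat.natCast_ne_top N) upper
  have : Nonempty V := ⟨r₀⟩
  have hconn := SimpleGraph.connected_of_ediam_ne_top htop
  refine ⟨hconn, le_antisymm (ENat.toNat_le_of_le_natCast upper) ?_⟩
  obtain ⟨p, hp⟩ := hconn.exists_walk_length_eq_dist r₀ r₁
  calc N = φ r₁ := hr₁.symm
    _ ≤ φ r₀ + p.length := le_add_length_of_walk lip p
    _ = G.dist r₀ r₁ := by rw [hr₀, hp, zero_add]
    _ ≤ G.diam := SimpleGraph.dist_le_diam htop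

/-- Two statistics `d` and `t` on the common vertices of two graphs, such that an edge of `H₁`
changes only `d`, an edge of `H₂` changes only `t`, and both increase by at most one along an edge.
At most one vertex is a zero of both, and every other vertex has an edge that lowers one
of them. -/
structure IsBigrading (H₁ H₂ : SimpleGraph V) (d t : V → ℕ) : Prop where
  adj₁ : ∀ u v, H₁.Adj u v → t v = t u ∧ d v ≤ d u + 1
  adj₂ : ∀ u v, H₂.Adj u v → d v = d u ∧ t v ≤ t u + 1
  eq_of_eq_zero : ∀ u v, d u = 0 ∧ t u = 0 → d v = 0 ∧ t v = 0 → u = v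
  lower : ∀ u, ¬ (d u = 0 ∧ t u = 0) →
    ∃ v, (H₁.Adj u v ∧ d v < d u) ∨ (H₂.Adj u v ∧ t v < t u)

namespace IsBigrading

variable {H₁ H₂ : SimpleGraph V} {d t d' t' : V → ℕ}

theorem swap (h : IsBigrading H₁ H₂ d t) : IsBigrading H₂ H₁ t d where
  adj₁ := h.adj₂
  adj₂ := h.adj₁
  eq_of_eq_zero u v hu hv := h.eq_of_eq_zero u v hu.symm hv.symm
  lower u hu := (h.lower u (mt And.symm hu)).imp fun _ => Or.symm

theorem exists_eq_zero [Nonempty V] (h : IsBigrading H₁ H₂ d t) : ∃ r, d r = 0 ∧ t r = 0 := by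
  obtain ⟨r, -, hmin⟩ := (measure fun u => d u + t u).wf.has_min Set.univ Set.univ_nonempty
  refine ⟨r, by_contra fun hr => ?_⟩
  obtain ⟨v, ⟨hadj, hv⟩ | ⟨hadj, hv⟩⟩ := h.lower r hr
  · exact hmin v trivial (add_lt_add_of_lt_of_le hv (h.adj₁ r v hadj).1.le)
  · exact hmin v trivial (add_lt_add_of_le_of_lt (h.adj₂ r v hadj).1.le hv)

variable {G : SimpleGraph W} {π : V → W} {a b : ℕ}

theorem edist_le (h : IsBigrading H₁ H₂ d t)
    (c₁ : ∀ u v, H₁.Adj u v → G.edist (π u) (π v) ≤ a)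
    (c₂ : ∀ u v, H₂.Adj u v → G.edist (π u) (π v) ≤ b) {r : V} (hr : d r = 0 ∧ t r = 0) (u : V) :
    G.edist (π u) (π r) ≤ (a * d u + b * t u : ℕ) := by
  induction hk : d u + t u using Nat.strong_induction_on generalizing u with
  | _ k ih =>
    by_cases hu : d u = 0 ∧ t u = 0
    · rw [h.eq_of_eq_zero u r hu hr, SimpleGraph.edist_self]
      exact zero_le
    · obtain ⟨v, ⟨hadj, hv⟩ | ⟨hadj, hv⟩⟩ := h.lower u hu
      · have ht := (h.adj₁ u v hadj).1
        calc G.edist (π u) (π r) ≤ G.edist (π u) (π v) + G.edist (π v) (π r) :=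
              SimpleGraph.edist_triangle
          _ ≤ a + (a * d v + b * t v : ℕ) := add_le_add (c₁ u v hadj) (ih _ (by omega) v rfl)
          _ ≤ (a * d u + b * t u : ℕ) := by
            rw [ht]
            norm_cast
            nlinarith
      · have hd := (h.adj₂ u v hadj).1
        calc G.edist (π u) (π r) ≤ G.edist (π u) (π v) + G.edist (π v) (π r) :=
              SimpleGraph.edist_triangle
          _ ≤ b + (a * d v + b * t v : ℕ) := add_le_add (c₂ u v hadj) (ih _ (by omega) v rfl)
          _ ≤ (a * d u + b * t u : ℕ) := by
            rw [hd]
            norm_cast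
            nlinarith

variable [Nonempty V] {D T : ℕ}

theorem connected_and_diam_eq (h : IsBigrading H₁ H₂ d t) (h' : IsBigrading H₁ H₂ d' t')
    (hd : ∀ u, d' u + d u = D) (ht : ∀ u, t' u + t u = T) (hπ : Function.Surjective π) {φ : W → ℕ}
    (hφ : ∀ u, φ (π u) = a * d u + b * t u) (lip : ∀ x y, G.Adj x y → φ y ≤ φ x + 1)
    (c₁ : ∀ u v, H₁.Adj u v → G.edist (π u) (π v) ≤ a)
    (c₂ : ∀ u v, H₂.Adj u v → G.edist (π u) (π v) ≤ b) :
    G.Connected ∧ G.diam = a * D + b * T := by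
  obtain ⟨r₀, hr₀⟩ := h.exists_eq_zero
  obtain ⟨r₁, hr₁⟩ := h'.exists_eq_zero
  have hsum u : a * d' u + b * t' u + φ (π u) = a * D + b * T := by
    rw [hφ, ← hd u, ← ht u]
    ring
  refine connected_and_diam_eq_of_potential (φ := φ) (r₀ := π r₀) (r₁ := π r₁)
    (hπ.forall.2 fun u => ?_) ?_ ?_ lip (hπ.forall.2 fun u => ?_) (hπ.forall.2 fun u => ?_)
  · exact le_of_add_le_right (hsum u).le
  · rw [hφ, hr₀.1, hr₀.2, mul_zero, mul_zero, add_zero]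
  · rw [← hsum r₁, hr₁.1, hr₁.2, mul_zero, mul_zero, zero_add, zero_add]
  · rw [hφ]
    exact h.edist_le c₁ c₂ hr₀ u
  · rw [← Nat.eq_sub_of_add_eq (hsum u)]
    exact h'.edist_le c₁ c₂ hr₁ u

theorem sup_connected_and_diam_eq (h : IsBigrading H₁ H₂ d t) (h' : IsBigrading H₁ H₂ d' t')
    (hd : ∀ u, d' u + d u = D) (ht : ∀ u, t' u + t u = T) :
    (H₁ ⊔ H₂).Connected ∧ (H₁ ⊔ H₂).diam = D + T := by
  have lip : ∀ u v, (H₁ ⊔ H₂).Adj u v → d v + t v ≤ d u + t u + 1 := by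
    rintro u v (hadj | hadj)
    · have := h.adj₁ u v hadj
      omega
    · have := h.adj₂ u v hadj
      omega
  have := h.connected_and_diam_eq h' hd ht (π := id) (a := 1) (b := 1) Function.surjective_id
    (fun u => by rw [one_mul, one_mul, id]) lip
    (fun u v hadj => (SimpleGraph.edist_eq_one_iff_adj.2 (Or.inl hadj)).le)
    (fun u v hadj => (SimpleGraph.edist_eq_one_iff_adj.2 (Or.inr hadj)).le)
  rwa [one_mul, one_mul] at this

end IsBigrading

theorem eq_of_walk {H : SimpleGraph V} {t : V → ℕ} (h : ∀ u v, H.Adj u v → t v = t u) {u v : V}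
    (p : H.Walk u v) : t u = t v := by
  induction p with
  | nil => rfl
  | cons hadj p ih => rw [← ih, h _ _ hadj]

theorem edist_contractAlong_le_one {G H : SimpleGraph V} {u v : V} (h : G.Adj u v) :
    (contractAlong G H).edist (H.connectedComponentMk u) (H.connectedComponentMk v) ≤ 1 := by
  by_cases huv : H.connectedComponentMk u = H.connectedComponentMk v
  · rw [huv, SimpleGraph.edist_self]
    exact zero_le
  · have hadj : (contractAlong G H).Adj (H.connectedComponentMk u) (H.connectedComponentMk v) :=
      ⟨huv, u, v, rfl, rfl, h⟩
    exact (SimpleGraph.edist_eq_one_iff_adj.2 hadj).le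

theorem edist_contractAlong_le_zero {G H : SimpleGraph V} {u v : V} (h : H.Adj u v) :
    (contractAlong G H).edist (H.connectedComponentMk u) (H.connectedComponentMk v) ≤ 0 := by
  rw [SimpleGraph.ConnectedComponent.eq.2 h.reachable, SimpleGraph.edist_self]

theorem IsBigrading.contractAlong_connected_and_diam_eq [Nonempty V] {H₁ H₂ : SimpleGraph V}
    {d t d' t' : V → ℕ} {D T : ℕ} (h : IsBigrading H₁ H₂ d t) (h' : IsBigrading H₁ H₂ d' t')
    (hd : ∀ u, d' u + d u = D) (ht : ∀ u, t' u + t u = T) :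
    (contractAlong (H₁ ⊔ H₂) H₁).Connected ∧ (contractAlong (H₁ ⊔ H₂) H₁).diam = T := by
  let φ : H₁.ConnectedComponent → ℕ := SimpleGraph.ConnectedComponent.lift t
    fun _ _ p _ => eq_of_walk (fun u v hadj => (h.adj₁ u v hadj).1) p
  have lip : ∀ x y, (contractAlong (H₁ ⊔ H₂) H₁).Adj x y → φ y ≤ φ x + 1 := by
    rintro _ _ ⟨-, u, v, rfl, rfl, hadj | hadj⟩
    · exact (h.adj₁ u v hadj).1.le.trans (Nat.le_succ _)
    · exact (h.adj₂ u v hadj).2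
  have := h.connected_and_diam_eq h' hd ht (π := H₁.connectedComponentMk) (a := 0) (b := 1)
    Quot.mk_surjective (φ := φ) (fun u => by rw [zero_mul, one_mul, zero_add]; rfl) lip
    (fun _ _ => edist_contractAlong_le_zero)
    (fun _ _ hadj => edist_contractAlong_le_one (Or.inr hadj))
  rwa [zero_mul, one_mul, zero_add] at this

end Graphs

section Longest

variable {n : ℕ}

theorem PairCommMove.of_reverse {l l' : List (ℕ × ℕ)} (h : PairCommMove l.reverse l') :
    PairCommMove l l'.reverse :=
  l.reverse_reverse ▸ h.reverse

theorem PairBraidMove.of_reverse {l l' : List (ℕ × ℕ)} (h : PairBraidMove l.reverse l') :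
    PairBraidMove l l'.reverse :=
  l.reverse_reverse ▸ h.reverse

theorem isBigrading_of_isConvexOrder {V : Type*} {H₁ H₂ : SimpleGraph V}
    {ℓ : V → List (ℕ × ℕ)} (hℓ : ∀ u, IsConvexOrder n (ℓ u)) (hinj : Function.Injective ℓ)
    (comm : ∀ u v, H₁.Adj u v → PairCommMove (ℓ u) (ℓ v))
    (braid : ∀ u v, H₂.Adj u v → PairBraidMove (ℓ u) (ℓ v))
    (lift_comm : ∀ u l, PairCommMove (ℓ u) l → ∃ v, H₁.Adj u v ∧ ℓ v = l)
    (lift_braid : ∀ u l, PairBraidMove (ℓ u) l → ∃ v, H₂.Adj u v ∧ ℓ v = l) :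
    IsBigrading H₁ H₂ (fun u => reversals (quadruples n) (ℓ u))
      (fun u => reversals (triples n) (ℓ u)) where
  adj₁ u v h := ⟨(comm u v h).reversals_triples, (comm u v h).reversals_quadruples_le⟩
  adj₂ u v h := ⟨(braid u v h).reversals_quadruples, (braid u v h).reversals_triples_le⟩
  eq_of_eq_zero u v hu hv :=
    hinj ((hℓ u).eq_of_reversals_eq_zero (hℓ v) hu.2 hu.1 hv.2 hv.1)
  lower u hu := by
    obtain ⟨l, ⟨h, hl⟩ | ⟨h, hl⟩⟩ := (hℓ u).exists_lowering_move (mt And.symm hu)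
    · obtain ⟨v, hadj, rfl⟩ := lift_comm u l h
      exact ⟨v, Or.inl ⟨hadj, hl⟩⟩
    · obtain ⟨v, hadj, rfl⟩ := lift_braid u l h
      exact ⟨v, Or.inr ⟨hadj, hl⟩⟩

theorem pairCommMove_of_adj {π : Equiv.Perm (Fin n)} {u v : R π} (h : (commGraph π).Adj u v) :
    PairCommMove (crossings 1 u.1) (crossings 1 v.1) :=
  CommMove.pairCommMove h

theorem pairBraidMove_of_adj {π : Equiv.Perm (Fin n)} {u v : R π} (h : (braidGraph π).Adj u v) :
    PairBraidMove (crossings 1 u.1) (crossings 1 v.1) :=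
  BraidMove.pairBraidMove h u.2.ascending_and_nodup.1

theorem exists_commGraph_adj {π : Equiv.Perm (Fin n)} {u : R π} {l : List (ℕ × ℕ)}
    (h : PairCommMove (crossings 1 u.1) l) :
    ∃ v : R π, (commGraph π).Adj u v ∧ crossings 1 v.1 = l := by
  obtain ⟨w, hw, rfl⟩ := exists_commMove h
  exact ⟨⟨w, hw.isReducedWord u.2⟩, hw, rfl⟩

theorem exists_braidGraph_adj {π : Equiv.Perm (Fin n)} {u : R π} {l : List (ℕ × ℕ)}
    (h : PairBraidMove (crossings 1 u.1) l) :
    ∃ v : R π, (braidGraph π).Adj u v ∧ crossings 1 v.1 = l := by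
  obtain ⟨w, hw, rfl⟩ := exists_braidMove h
  exact ⟨⟨w, hw.isReducedWord u.2⟩, hw, rfl⟩

/-- The number of pairs of disjoint pairs of values that cross in decreasing order. -/
def commRank (w : R (longest n)) : ℕ := reversals (quadruples n) (crossings 1 w.1)

/-- The number of triples of values that cross in decreasing order. -/
def braidRank (w : R (longest n)) : ℕ := reversals (triples n) (crossings 1 w.1)

/-- The number of pairs of disjoint pairs of values that cross in increasing order. -/
def commCorank (w : R (longest n)) : ℕ := reversals (quadruples n) (crossings 1 w.1).reverse

/-- The number of triples of values that cross in increasing order. -/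
def braidCorank (w : R (longest n)) : ℕ := reversals (triples n) (crossings 1 w.1).reverse

theorem commCorank_add_commRank (u : R (longest n)) :
    commCorank u + commRank u = 3 * n.choose 4 :=
  (isConvexOrder_crossings u.2).reversals_quadruples_reverse_add.trans (card_quadruples n)

theorem braidCorank_add_braidRank (u : R (longest n)) :
    braidCorank u + braidRank u = n.choose 3 :=
  (isConvexOrder_crossings u.2).reversals_triples_reverse_add.trans (card_triples n)

theorem crossings_val_injective {π : Equiv.Perm (Fin n)} :
    Function.Injective fun u : R π => crossings 1 u.1 :=
  (crossings_injective 1).comp Subtype.val_injective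

theorem isBigrading_rank (n : ℕ) :
    IsBigrading (commGraph (longest n)) (braidGraph (longest n)) commRank braidRank :=
  isBigrading_of_isConvexOrder (fun u => isConvexOrder_crossings u.2) crossings_val_injective
    (fun _ _ => pairCommMove_of_adj) (fun _ _ => pairBraidMove_of_adj)
    (fun _ _ => exists_commGraph_adj) (fun _ _ => exists_braidGraph_adj)

theorem isBigrading_corank (n : ℕ) :
    IsBigrading (commGraph (longest n)) (braidGraph (longest n)) commCorank braidCorank := by
  refine isBigrading_of_isConvexOrder (fun u => (isConvexOrder_crossings u.2).reverse)
    (List.reverse_injective.comp crossings_val_injective)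
    (fun _ _ h => (pairCommMove_of_adj h).reverse) (fun _ _ h => (pairBraidMove_of_adj h).reverse)
    (fun u l h => ?_) (fun u l h => ?_)
  · obtain ⟨v, hadj, hv⟩ := exists_commGraph_adj h.of_reverse
    exact ⟨v, hadj, List.reverse_eq_iff.2 hv⟩
  · obtain ⟨v, hadj, hv⟩ := exists_braidGraph_adj h.of_reverse
    exact ⟨v, hadj, List.reverse_eq_iff.2 hv⟩

instance nonempty_R (π : Equiv.Perm (Fin n)) : Nonempty (R π) :=
  let ⟨w, hw⟩ := exists_isReducedWord π
  ⟨⟨w, hw⟩⟩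

theorem graphG_connected_and_diam (n : ℕ) :
    (graphG (longest n)).Connected ∧ D n = 3 * n.choose 4 + n.choose 3 :=
  (isBigrading_rank n).sup_connected_and_diam_eq (isBigrading_corank n)
    commCorank_add_commRank braidCorank_add_braidRank

theorem graphC_connected_and_diam (n : ℕ) :
    (graphC (longest n)).Connected ∧ C n = n.choose 3 :=
  (isBigrading_rank n).contractAlong_connected_and_diam_eq (isBigrading_corank n)
    commCorank_add_commRank braidCorank_add_braidRank

theorem graphB_connected_and_diam (n : ℕ) :
    (graphB (longest n)).Connected ∧ B n = 3 * n.choose 4 := by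
  have := (isBigrading_rank n).swap.contractAlong_connected_and_diam_eq
    (isBigrading_corank n).swap braidCorank_add_braidRank commCorank_add_commRank
  rwa [sup_comm] at this

theorem cast_succ_mul_choose_succ {A : Type*} [CommRing A] (n k : ℕ) :
    (k + 1 : A) * n.choose (k + 1) = (n - k) * n.choose k := by
  rcases le_or_gt k n with h | h
  · have := congrArg (Nat.cast : ℕ → A) (Nat.choose_succ_right_eq n k)
    push_cast [h] at this
    linear_combination this
  · rw [Nat.choose_eq_zero_of_lt h, Nat.choose_eq_zero_of_lt (h.trans (Nat.lt_succ_self k))]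
    simp

theorem three_mul_choose_four_succ (n : ℕ) : 3 * ((n + 1).choose 4 : ℤ) =
    3 * n.choose 4 + (n - 2) * n.choose 2 := by
  have h := cast_succ_mul_choose_succ (A := ℤ) n 2
  rw [Nat.choose_succ_succ n 3]
  push_cast at h ⊢
  linear_combination h

theorem three_mul_choose_four_add_choose_three (n : ℕ) :
    (3 * n.choose 4 + n.choose 3 : ℚ) = n * (n - 1) * (n - 2) * (3 * n - 5) / 24 := by
  have h₂ := Nat.cast_choose_two ℚ n
  have h₃ := cast_succ_mul_choose_succ (A := ℚ) n 2
  have h₄ := cast_succ_mul_choose_succ (A := ℚ) n 3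
  push_cast at h₃ h₄
  linear_combination 3 / 4 * h₄ + (3 * n - 5 : ℚ) / 12 * h₃ + (3 * n - 5 : ℚ) * (n - 2) / 12 * h₂

end Longest

end ReducedWords

theorem corollary4p8 :
    -- the graphs are connected, so that their diameters are defined
    (∀ n : ℕ, 1 ≤ n →
      (ReducedWords.graphG (ReducedWords.longest n)).Connected ∧
      (ReducedWords.graphC (ReducedWords.longest n)).Connected ∧
      (ReducedWords.graphB (ReducedWords.longest n)).Connected) ∧
    -- initial values
    (ReducedWords.D 1 = 0 ∧ ReducedWords.C 1 = 0 ∧ ReducedWords.B 1 = 0) ∧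
    -- recursions, in `ℤ` so that no subtraction is truncated
    (∀ n : ℕ, 1 ≤ n →
      (ReducedWords.D (n + 1) : ℤ) = ReducedWords.D n + ((n : ℤ) - 1) * (n.choose 2 : ℤ) ∧
      (ReducedWords.C (n + 1) : ℤ) = ReducedWords.C n + (n.choose 2 : ℤ) ∧
      (ReducedWords.B (n + 1) : ℤ) = ReducedWords.B n + ((n : ℤ) - 2) * (n.choose 2 : ℤ)) ∧
    -- the resulting value of the diameter of `G_{δ_n}`
    (∀ n : ℕ, 1 ≤ n →
      (ReducedWords.D n : ℚ) =
        (n : ℚ) * ((n : ℚ) - 1) * ((n : ℚ) - 2) * (3 * (n : ℚ) - 5) / 24) := by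
  have hD n : ReducedWords.D n = _ := (ReducedWords.graphG_connected_and_diam n).2
  have hC n : ReducedWords.C n = _ := (ReducedWords.graphC_connected_and_diam n).2
  have hB n : ReducedWords.B n = _ := (ReducedWords.graphB_connected_and_diam n).2
  refine ⟨fun n _ => ⟨(ReducedWords.graphG_connected_and_diam n).1,
    (ReducedWords.graphC_connected_and_diam n).1, (ReducedWords.graphB_connected_and_diam n).1⟩,
    ⟨hD 1, hC 1, hB 1⟩, fun n _ => ?_, fun n _ => ?_⟩
  · have h₃ : ((n + 1).choose 3 : ℤ) = n.choose 3 + n.choose 2 := by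
      rw [Nat.choose_succ_succ n 2, Nat.cast_add, add_comm]
    have h₄ := ReducedWords.three_mul_choose_four_succ n
    rw [hD, hD, hC, hC, hB, hB]
    push_cast
    exact ⟨by linear_combination h₃ + h₄, h₃, h₄⟩
  · rw [hD]
    exact_mod_cast ReducedWords.three_mul_choose_four_add_choose_three n
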